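/- Let $S^2\subset\mathbb R^3$ be the unit sphere with its surface measure, let $Q_m$ be the orthogonal projection of the real space $L^2(S^2)$ onto the spherical harmonics of degree $m$ (restrictions to $S^2$ of harmonic homogeneous polynomials of degree $m$), and for $R>1$ let $$Tf=\sum_{m=0}^\infty\frac{(m+1)(m+2)}{R^{m+3}}\,Q_mf,\qquad f\in L^2(S^2),$$ be the gradiometry operator. *Analytic spaces.* Let $\lambda:[0,\infty)\to\mathbb R\cup\{\infty\}$ be non-decreasing with $B_\lambda:=\sup\{r\ge 0:\lambda(r)<\infty\}>0$. For $r>0$ let $\mathcal E_r=\{x+\mathrm iy:\ x^2/\cosh^2 r+y^2/\sinh^2 r\le 1\}$. The space $A^\lambda(-1,1)$ consists of the functions $h$ on $(-1,1)$ that have a holomorphic extension $\tilde h$ to the open ellipse $\bigcup_{0<r<B_\lambda}\mathcal E_r$ with $$\|h\|_{A^\lambda(-1,1)}:=\sup_{0<t<B_\lambda}e^{-\lambda(t)}\sup_{z\in\partial\mathcal E_t}|\tilde h(z)|<\infty.$$ For $g\in C(S^2)$, $x\in S^2$ and $-1\le t\le 1$ let $(Mg)(x,t)$ be the average of $g$ over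 the circle $\{y\in S^2:\langle x,y\rangle=t\}$ with respect to arc length (with $(Mg)(x,\pm1)=g(\pm x)$). The space $A^\lambda(S^2)$ consists of the $g\in C(S^2)$ with $(Mg)(x,\cdot)\in A^\lambda(-1,1)$ for all $x\in S^2$ and $\|g\|_{A^\lambda(S^2)}:=\sup_{x\in S^2}\|(Mg)(x,\cdot)\|_{A^\lambda(-1,1)}<\infty$. *Logarithmic functions.* For $s>0$ let $\varphi_s(0)=0$, $\varphi_s(t)=(-\ln t)^{-s}$ for $0<t\le e^{-(s+1)}$, and $\varphi_s(t)=(s+1)^{-s-1}\left(1+s\,e^{s+1}t\right)$ for $t>e^{-(s+1)}$ (the continuation by the tangent at the inflection point $e^{-(s+1)}$). For $p>0$, $u\in H^p(S^2)$ means $\sum_m(1+m(m+1))^p\|Q_mu\|_{L^2}^2<\infty$. Then the following holds. 1. For every $R>1$, $T$ is bounded from $L^2(S^2)$ to $A^\lambda(S^2)$ with $\lambda(r)=-4\ln(R-e^r)$ for $0\le r<\ln R$ and $\lambda(r)=\infty$ for $r\ge\ln R$; that is, each $Tf$ has a continuous representative in $A^\lambda(S^2)$, whose norm is at most $K\|f\|_{L^2(S^2)}$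 with $K$ independent of $f$. 2. There is a constant $C>0$ such that for every $R>1$ there is $\delta_0>0$ with the following property. Put $$\gamma(\delta)=C\,\delta^{-5/2}R^{-\sqrt{4\pi/\delta}-4}\quad(0<\delta\le\delta_0),\qquad\gamma(0)=0.$$ Then $\gamma$ is increasing on $[0,\delta_0]$, $\gamma(\delta)\to0$ as $\delta\searrow0$, and for all $u^\dagger,f\in L^2(S^2)$ and all $0<\delta\le\delta_0$ $$\|Tf-Tu^\dagger\|_{L^\infty(S^2)}\le\gamma(\delta)\,D(f,u^\dagger)^{1/2}+\frac1\delta\|Tf-Tu^\dagger\|_{L^1(S^2)},$$ where $D(f,u^\dagger)=\mathcal R(f)-\mathcal R(u^\dagger)-\langle f^*,f-u^\dagger\rangle$ with $f^*\in\partial\mathcal R(u^\dagger)$ is the Bregman distance of the convex, lower semicontinuous functional $\mathcal R(f)=\|f\|_{L^2(S^2)}^2$. 3. Let $R>1$, $p>0$, $u^\dagger\in H^p(S^2)$, and let $\mathcal D\subset L^2(S^2)$ be bounded. Then there are $\beta,\beta'>0$ such that $\varphi=\beta'\varphi_{2p}$ is concave and increasing on $[0,\infty)$ with $\varphi(0)=0$,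 and $$\beta\,D(f,u^\dagger)\le\|f\|_{L^2(S^2)}^2-\|u^\dagger\|_{L^2(S^2)}^2+\varphi\left(\|Tf-Tu^\dagger\|_{L^1(S^2)}\right)\qquad\text{for all }f\in\mathcal D .$$ -/

import Mathlib

open MeasureTheory Filter Topology
open scoped NNReal ENNReal

noncomputable section

/-! The unit sphere with its surface measure, and the real space `L²` on it. -/

/-- Euclidean three-space. -/
abbrev E3 : Type := EuclideanSpace ℝ (Fin 3)

/-- The unit sphere in Euclidean three-space. -/
abbrev S2 : Type := Metric.sphere (0 : E3) 1

/-- The surface measure of the unit sphere (total mass `4π`). -/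
abbrev surf : Measure S2 := (volume : Measure E3).toSphere

/-- The real Hilbert space `L²(S²)`. -/
abbrev L2S2 : Type := Lp ℝ 2 surf

/-! Spherical harmonics. -/

/-- The Laplacian of a polynomial in three variables. -/
def polyLaplacian : MvPolynomial (Fin 3) ℝ →ₗ[ℝ] MvPolynomial (Fin 3) ℝ :=
  ∑ i : Fin 3, (MvPolynomial.pderiv i).toLinearMap ∘ₗ (MvPolynomial.pderiv i).toLinearMap

/-- Restriction of a polynomial in three variables to the unit sphere. -/
def restrictS2 : MvPolynomial (Fin 3) ℝ →ₗ[ℝ] C(S2, ℝ) where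
  toFun p := ⟨fun x => MvPolynomial.eval (fun i => (x : E3) i) p,
    (MvPolynomial.continuous_eval p).comp
      (continuous_pi fun i => (EuclideanSpace.proj (𝕜 := ℝ) i).continuous.comp
        continuous_subtype_val)⟩
  map_add' p q := by ext x; simp
  map_smul' c p := by ext x; simp

/-- The spherical harmonics of degree `m`: restrictions to the sphere of harmonic homogeneous
polynomials of degree `m`. -/
def sphHarm (m : ℕ) : Submodule ℝ C(S2, ℝ) :=
  (MvPolynomial.homogeneousSubmodule (Fin 3) ℝ m ⊓ LinearMap.ker polyLaplacian).map restrictS2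

/-- The spherical harmonics of degree `m` as a subspace of `L²(S²)`. -/
def sphHarmL2 (m : ℕ) : Submodule ℝ L2S2 :=
  (sphHarm m).map (ContinuousMap.toLp 2 surf ℝ : C(S2, ℝ) →L[ℝ] L2S2).toLinearMap

instance sphHarmL2_finiteDimensional (m : ℕ) : FiniteDimensional ℝ (sphHarmL2 m) := by
  have h := MvPolynomial.homogeneousSubmodule_fg (σ := Fin 3) (R := ℝ) m
  have h1 : FiniteDimensional ℝ (MvPolynomial.homogeneousSubmodule (Fin 3) ℝ m) :=
    Module.Finite.iff_fg.mpr h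
  have h2 : FiniteDimensional ℝ
      (MvPolynomial.homogeneousSubmodule (Fin 3) ℝ m ⊓ LinearMap.ker polyLaplacian :
        Submodule ℝ (MvPolynomial (Fin 3) ℝ)) :=
    Submodule.finiteDimensional_of_le inf_le_left
  unfold sphHarmL2 sphHarm
  infer_instance

/-- The orthogonal projection of `L²(S²)` onto the spherical harmonics of degree `m`. -/
def Qproj (m : ℕ) : L2S2 →L[ℝ] L2S2 := (sphHarmL2 m).starProjection

/-- The gradiometry operator `T = ∑ₘ (m+1)(m+2) R^{-(m+3)} Qₘ` (the series converges in operator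
norm for `R > 1`); it maps the boundary values `f` of an exterior harmonic function
`u(x) = ∑ₘ |x|^{-(m+1)} (Qₘ f)(x/|x|)` to `∂²u/∂r²` on the sphere of radius `R`. -/
def gradiometry (R : ℝ) : L2S2 →L[ℝ] L2S2 :=
  ∑' m : ℕ, (((m : ℝ) + 1) * ((m : ℝ) + 2) / R ^ (m + 3)) • Qproj m

/-- The Sobolev space `H^p(S²)`: finiteness of `‖(1 - Δ)^{p/2} u‖²`, where the
Laplace-Beltrami operator `Δ` has eigenvalue `-m(m+1)` on spherical harmonics of degree `m`. -/
def MemSobolev (p : ℝ) (u : L2S2) : Prop :=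
  Summable fun m : ℕ => (1 + (m : ℝ) * ((m : ℝ) + 1)) ^ p * ‖Qproj m u‖ ^ 2

/-! Averages over circles. -/

lemma exists_frame (x : E3) : ∃ e : E3 × E3, ‖e.1‖ = 1 ∧ ‖e.2‖ = 1 ∧
    inner ℝ x e.1 = 0 ∧ inner ℝ x e.2 = 0 ∧ inner ℝ e.1 e.2 = 0 := by
  have key : ∀ a b : E3, ∃ e : E3, ‖e‖ = 1 ∧ inner ℝ a e = 0 ∧ inner ℝ b e = 0 := by
    intro a b
    have hK : Submodule.span ℝ (({a, b} : Finset E3) : Set E3) ≠ ⊤ := by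
      intro h
      have h1 := finrank_span_finset_le_card (R := ℝ) ({a, b} : Finset E3)
      rw [Set.finrank, h, finrank_top, finrank_euclideanSpace_fin] at h1
      have h2 := Finset.card_le_two (a := a) (b := b)
      omega
    have hK' : (Submodule.span ℝ (({a, b} : Finset E3) : Set E3))ᗮ ≠ ⊥ := fun h =>
      hK (Submodule.orthogonal_eq_bot_iff.mp h)
    obtain ⟨v, hv, hv0⟩ := Submodule.exists_mem_ne_zero_of_ne_bot hK'
    rw [Submodule.mem_orthogonal] at hv
    have ha := hv a (Submodule.subset_span (by simp))
    have hb := hv b (Submodule.subset_span (by simp))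
    refine ⟨(‖v‖⁻¹ : ℝ) • v, ?_, ?_, ?_⟩
    · rw [norm_smul, norm_inv, norm_norm, inv_mul_cancel₀ (norm_ne_zero_iff.mpr hv0)]
    · rw [inner_smul_right, ha, mul_zero]
    · rw [inner_smul_right, hb, mul_zero]
  obtain ⟨e, he, hxe, -⟩ := key x x
  obtain ⟨e', he', hxe', hee'⟩ := key x e
  exact ⟨(e, e'), he, he', hxe, hxe', hee'⟩

/-- An orthonormal pair spanning the plane orthogonal to `x`. -/
def frame (x : S2) : E3 × E3 := (exists_frame (x : E3)).choose

/-- The point with angle `θ` on the circle `{y ∈ S² | ⟨y, x⟩ = t}`. -/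
def circlePoint (x : S2) (t : Set.Icc (-1 : ℝ) 1) (θ : ℝ) : S2 :=
  ⟨(t : ℝ) • (x : E3) + √(1 - (t : ℝ) ^ 2) •
      (Real.cos θ • (frame x).1 + Real.sin θ • (frame x).2), by
    obtain ⟨h1, h2, h3, h4, h5⟩ := (exists_frame (x : E3)).choose_spec
    have hx : ‖(x : E3)‖ = 1 := by simp
    have ht : 0 ≤ 1 - (t : ℝ) ^ 2 := by nlinarith [t.2.1, t.2.2]
    change ‖(frame x).1‖ = 1 at h1
    change ‖(frame x).2‖ = 1 at h2
    change inner ℝ (x : E3) (frame x).1 = 0 at h3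
    change inner ℝ (x : E3) (frame x).2 = 0 at h4
    change inner ℝ (frame x).1 (frame x).2 = 0 at h5
    rw [mem_sphere_zero_iff_norm]
    have hsq : ‖(t : ℝ) • (x : E3) + √(1 - (t : ℝ) ^ 2) •
        (Real.cos θ • (frame x).1 + Real.sin θ • (frame x).2)‖ ^ 2 = 1 := by
      rw [norm_add_sq_real, norm_smul, norm_smul, mul_pow, mul_pow, norm_add_sq_real]
      simp only [inner_add_right, inner_smul_left, inner_smul_right, norm_smul, h1, h2, h3, h4,
        h5, hx, Real.norm_eq_abs, sq_abs, Real.sq_sqrt ht, conj_trivial, mul_zero, mul_one,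
        add_zero, one_pow]
      rw [Real.cos_sq_add_sin_sq]
      ring
    exact (pow_eq_one_iff_of_nonneg (norm_nonneg _) two_ne_zero).mp hsq⟩

/-- The average of `g` over the circle `{y ∈ S² | ⟨y, x⟩ = t}` with respect to arc length
`√(1 - t²) dθ`; for `t = ± 1` this is `g (± x)`. -/
def circleMean (g : C(S2, ℝ)) (x : S2) (t : Set.Icc (-1 : ℝ) 1) : ℝ :=
  (2 * Real.pi)⁻¹ * ∫ θ in (0 : ℝ)..(2 * Real.pi), g (circlePoint x t θ)

/-! Spaces of analytic functions with weight `lam : [0, ∞) → ℝ ∪ {∞}`. -/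

/-- `B_λ = sup {r | λ(r) < ∞}`. -/
def weightRadius (lam : ℝ≥0 → EReal) : ℝ≥0∞ := ⨆ (r : ℝ≥0) (_ : lam r < ⊤), (r : ℝ≥0∞)

/-- The closed region bounded by the ellipse with foci `± 1` and semi-axes `cosh r`, `sinh r`. -/
def ellipse (r : ℝ≥0) : Set ℂ :=
  {z | z.re ^ 2 / Real.cosh r ^ 2 + z.im ^ 2 / Real.sinh r ^ 2 ≤ 1}

/-- The ellipse with foci `± 1` and semi-axes `cosh r`, `sinh r`. -/
def ellipseCurve (r : ℝ≥0) : Set ℂ :=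
  {z | z.re ^ 2 / Real.cosh r ^ 2 + z.im ^ 2 / Real.sinh r ^ 2 = 1}

/-- The open ellipse of parameter `B_λ`. -/
def ellipseDomain (lam : ℝ≥0 → EReal) : Set ℂ :=
  ⋃ (r : ℝ≥0) (_ : 0 < r) (_ : (r : ℝ≥0∞) < weightRadius lam), ellipse r

/-- `G` is a holomorphic extension of `h` from `(-1, 1)` to the open ellipse of parameter
`B_λ`. -/
def IsEllipseExtension (lam : ℝ≥0 → EReal) (h : Set.Icc (-1 : ℝ) 1 → ℝ) (G : ℂ → ℂ) : Prop :=
  DifferentiableOn ℂ G (ellipseDomain lam) ∧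
    ∀ t : Set.Icc (-1 : ℝ) 1, (t : ℝ) ∈ Set.Ioo (-1 : ℝ) 1 → G ((t : ℝ) : ℂ) = (h t : ℂ)

/-- The norm of `A^λ(-1,1)`, with value `∞` if there is no holomorphic extension (if there is one,
it is unique on the ellipse, so that the infimum is the value at this extension). -/
def intervalNorm (lam : ℝ≥0 → EReal) (h : Set.Icc (-1 : ℝ) 1 → ℝ) : ℝ≥0∞ :=
  ⨅ (G : ℂ → ℂ) (_ : IsEllipseExtension lam h G),
    ⨆ (t : ℝ≥0) (_ : 0 < t) (_ : (t : ℝ≥0∞) < weightRadius lam),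
      EReal.exp (-lam t) * ⨆ (z : ℂ) (_ : z ∈ ellipseCurve t), ‖G z‖ₑ

/-- Membership in `A^λ(-1,1)`. -/
def MemIntervalA (lam : ℝ≥0 → EReal) (h : Set.Icc (-1 : ℝ) 1 → ℝ) : Prop :=
  (∃ G, IsEllipseExtension lam h G) ∧ intervalNorm lam h < ⊤

/-- The norm of `A^λ(S²)`. -/
def sphereNorm (lam : ℝ≥0 → EReal) (g : C(S2, ℝ)) : ℝ≥0∞ :=
  ⨆ x : S2, intervalNorm lam (circleMean g x)

/-- Membership in `A^λ(S²)`. -/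
def MemSphereA (lam : ℝ≥0 → EReal) (g : C(S2, ℝ)) : Prop :=
  (∀ x : S2, MemIntervalA lam (circleMean g x)) ∧ sphereNorm lam g < ⊤

/-- The weight `λ(r) = -4 ln (R - e^r)` for `0 ≤ r < ln R`, and `∞` otherwise. -/
def gradWeight (R : ℝ) (r : ℝ≥0) : EReal :=
  if (r : ℝ) < Real.log R then ((-4 * Real.log (R - Real.exp r) : ℝ) : EReal) else ⊤

/-! Variational regularization. -/

section Regularization

variable {X : Type*} [NormedAddCommGroup X] [NormedSpace ℝ X]

/-- `ξ` is a subgradient of `J` at `u`. -/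
def IsSubgradient (J : X → ℝ) (u : X) (ξ : StrongDual ℝ X) : Prop :=
  ∀ f : X, J u + ξ (f - u) ≤ J f

/-- The Bregman distance of `f` to `u` for the functional `J` and the subgradient `ξ` at `u`. -/
def bregman (J : X → ℝ) (u : X) (ξ : StrongDual ℝ X) (f : X) : ℝ :=
  J f - J u - ξ (f - u)

variable {M : Type*} [MeasurableSpace M]

/-- The smoothing property of `F : X → L¹(M)` with exact solution `u`, exponent `q` and
function `γ` on `[0, δ₀]`. -/
structure SmoothingProperty (μ : Measure M) (F : X → M → ℝ) (J : X → ℝ) (u : X)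
    (ξ : StrongDual ℝ X) (q δ₀ : ℝ) (γ : ℝ → ℝ) : Prop where
  maps_L1 : ∀ f : X, MemLp (F f) 1 μ
  convex : ConvexOn ℝ Set.univ J
  lsc : LowerSemicontinuous J
  δ₀_pos : 0 < δ₀
  one_lt_q : 1 < q
  γ_nonneg : ∀ δ ∈ Set.Icc 0 δ₀, 0 ≤ γ δ
  γ_strictMono : StrictMonoOn γ (Set.Icc 0 δ₀)
  γ_tendsto : Tendsto γ (𝓝[>] 0) (𝓝 0)
  bound : ∀ δ : ℝ, 0 < δ → δ ≤ δ₀ → ∀ f : X,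
    eLpNorm (fun y => F f y - F u y) ⊤ μ ≤
      ENNReal.ofReal (γ δ * bregman J u ξ f ^ (1 / q)) +
        ENNReal.ofReal (1 / δ) * eLpNorm (fun y => F f y - F u y) 1 μ

/-- The `L^r` variational source condition at `u` for `F : D → L^r(M)` with constant `β` and
function `φ`. -/
structure VariationalSourceCondition (μ : Measure M) (F : X → M → ℝ) (D : Set X) (J : X → ℝ)
    (u : X) (ξ : StrongDual ℝ X) (r β : ℝ) (φ : ℝ → ℝ) : Prop where
  maps_Lr : ∀ f ∈ insert u D, MemLp (F f) (ENNReal.ofReal r) μ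
  β_pos : 0 < β
  φ_concave : ConcaveOn ℝ (Set.Ici 0) φ
  φ_strictMono : StrictMonoOn φ (Set.Ici 0)
  φ_zero : φ 0 = 0
  bound : ∀ f ∈ D, β * bregman J u ξ f ≤
    J f - J u + φ ((eLpNorm (fun y => F f y - F u y) (ENNReal.ofReal r) μ).toReal ^ r)

end Regularization

/-- The logarithmic function `φ_s(t) = (-ln t)^{-s}` (`s > 0`), which is concave for
`0 < t ≤ e^{-(s+1)}`, extended to a concave function on `[0, ∞)` by `φ_s(0) = 0` and by its tangent
at the inflection point `e^{-(s+1)}`. -/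
def logIndex (s t : ℝ) : ℝ :=
  if t ≤ 0 then 0
  else if t ≤ Real.exp (-(s + 1)) then (-Real.log t) ^ (-s)
  else (s + 1) ^ (-s - 1) * (1 + s * Real.exp (s + 1) * t)

end

/-! On degree `m` the operator is multiplication by `gradCoeff R m`, so everything rests on
pointwise bounds for the degree-`m` component. If `k` is the reproducing kernel of that space at
`x`, both `|k|` and `‖k‖²` are at most `(2m+1)/(4π)`. This bounds the component at `x` by `(m+1)‖f‖`
(`abs_component_le`) and by `(2m+1)/(4π)` times the `L¹` norm (`abs_component_le_integral`). The
kernel bounds need no Legendre functions: rotation generators are antisymmetric, so they act on an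
orthonormal basis by antisymmetric matrices, and the sum of squares of the basis is constant
(`sum_sq_orthonormalBasis`). Orthogonality of degrees comes from the eigenvalues of the Casimir
operator.

Analyticity: circle means of the degree-`m` component are polynomials of degree at most `m`, so
Bernstein's inequality costs a factor `e^{rm}` on the ellipse. Summing a cubic times a geometric
sequence yields `6R/(R-e^r)^4`, which the weight cancels.

Smoothing: cut the series at `n = ⌊√(4π/δ)⌋`. Below `n` the `L¹` bounds add up to `n²/(4π) ≤ 1/δ`;
above `n` the tail is of order `n³R^{-n-3}`. The two extra powers of `√(4π/δ)` in `γ` absorb all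
constants depending on `R` once `δ₀` is small, so `C` is independent of `R`.

Source condition: the Bregman distance is `‖h‖²` with `h = f - u`, so with `β = 1/2` one must bound
`-2⟨u,h⟩ - ‖h‖²/2`. Low degrees are recovered from `Th` at cost `R^n`; high degrees use Young's
inequality and the Sobolev decay `n^{-2p}` (`neg_inner_le`). Choosing `n` logarithmic in `‖Th‖₁`
balances the two (`exists_le_logIndex`). -/

noncomputable section

/-! ### Rotations and the surface measure -/

section Sphere

/-- A linear isometry acting on the unit sphere. -/
def sphereMap (L : E3 ≃ₗᵢ[ℝ] E3) (x : S2) : S2 :=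
  ⟨L x, by simp⟩

lemma continuous_sphereMap (L : E3 ≃ₗᵢ[ℝ] E3) : Continuous (sphereMap L) :=
  (L.continuous.comp continuous_subtype_val).subtype_mk _

/-- The surface measure of a set is a multiple of the volume of the cone over it, and a linear
isometry carries cones to cones and preserves volume. -/
lemma measurePreserving_sphereMap (L : E3 ≃ₗᵢ[ℝ] E3) :
    MeasurePreserving (sphereMap L) surf surf := by
  refine ⟨(continuous_sphereMap L).measurable, ?_⟩
  ext s hs
  rw [Measure.map_apply (continuous_sphereMap L).measurable hs,
    Measure.toSphere_apply' _ hs,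
    Measure.toSphere_apply' _ ((continuous_sphereMap L).measurable hs)]
  congr 1
  conv_rhs =>
    rw [← L.measurePreserving.measure_preimage_equiv (f := L.toHomeomorph.toMeasurableEquiv)]
  congr 1
  ext x
  simp only [Set.mem_smul, Set.mem_image, Set.mem_preimage]
  constructor
  · rintro ⟨r, hr, _, ⟨y, hy, rfl⟩, rfl⟩
    exact ⟨r, hr, L y, ⟨sphereMap L y, hy, rfl⟩, (L.map_smul r (y : E3)).symm⟩
  · rintro ⟨r, hr, _, ⟨y, hy, rfl⟩, h⟩
    refine ⟨r, hr, L.symm y, ⟨sphereMap L.symm y, ?_, rfl⟩, ?_⟩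
    · have : sphereMap L (sphereMap L.symm y) = y := by
        ext1; simp [sphereMap]
      rwa [this]
    · apply L.injective
      rw [L.map_smul, L.apply_symm_apply]
      exact h

lemma surf_univ : surf Set.univ = ENNReal.ofReal (4 * Real.pi) := by
  rw [Measure.toSphere_apply_univ, InnerProductSpace.volume_ball_of_dim_odd (k := 1) (by simp)]
  simp [Nat.doubleFactorial]
  rw [show (3 : ℝ≥0∞) = ENNReal.ofReal 3 by simp, show (4 : ℝ≥0∞) = ENNReal.ofReal 4 by simp,
    ← ENNReal.ofReal_mul (by norm_num), ← ENNReal.ofReal_mul (by norm_num)]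
  congr 1
  ring

lemma surf_real_univ : surf.real Set.univ = 4 * Real.pi := by
  rw [measureReal_def, surf_univ, ENNReal.toReal_ofReal (by positivity)]

lemma integrable_surf (g : C(S2, ℝ)) : Integrable (fun x => g x) surf :=
  g.continuous.integrable_of_hasCompactSupport (HasCompactSupport.of_compactSpace _)

/-- The rotation by the angle `θ` in the coordinate plane `(i, j)`. -/
def planeRotation (i j : Fin 3) (h : i ≠ j) (θ : ℝ) : E3 ≃ₗᵢ[ℝ] E3 :=
  LinearIsometry.toLinearIsometryEquiv
    { toFun := fun x => WithLp.toLp 2 (fun k => if k = i then Real.cos θ * x i - Real.sin θ * x j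
        else if k = j then Real.sin θ * x i + Real.cos θ * x j else x k)
      map_add' := by
        intro x y; ext k; simp; split_ifs <;> ring
      map_smul' := by
        intro c x; ext k; simp; split_ifs <;> ring
      norm_map' := by
        intro x
        have hs := Real.sin_sq_add_cos_sq θ
        rw [EuclideanSpace.norm_eq, EuclideanSpace.norm_eq]
        congr 1
        fin_cases i <;> fin_cases j <;> simp [Fin.sum_univ_three] at h ⊢ <;>
          first
          | linear_combination (x 0 ^ 2 + x 1 ^ 2) * hs
          | linear_combination (x 0 ^ 2 + x 2 ^ 2) * hs
          | linear_combination (x 1 ^ 2 + x 2 ^ 2) * hs }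
    rfl

lemma planeRotation_apply (i j : Fin 3) (h : i ≠ j) (θ : ℝ) (x : E3) (k : Fin 3) :
    planeRotation i j h θ x k = if k = i then Real.cos θ * x i - Real.sin θ * x j
        else if k = j then Real.sin θ * x i + Real.cos θ * x j else x k := rfl

end Sphere

/-! ### Infinitesimal rotations of polynomials and the Casimir operator -/

section Polynomials

open MvPolynomial

lemma hasDerivAt_eval {σ : Type*} [Fintype σ] {v : ℝ → σ → ℝ} {v' : σ → ℝ} {t : ℝ}
    (hv : ∀ i, HasDerivAt (fun s => v s i) (v' i) t) (p : MvPolynomial σ ℝ) :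
    HasDerivAt (fun s => eval (v s) p) (∑ i, v' i * eval (v t) (pderiv i p)) t := by
  classical
  induction p using MvPolynomial.induction_on with
  | C a => simpa using hasDerivAt_const t a
  | add p q hp hq =>
    simp only [map_add, mul_add, Finset.sum_add_distrib]
    exact hp.add hq
  | mul_X p k hp =>
    have h := hp.mul (hv k)
    simp only [map_mul, eval_X]
    refine h.congr_deriv ?_
    simp only [pderiv_mul, pderiv_X, map_add, map_mul, eval_X, mul_add, Finset.sum_add_distrib,
      Finset.sum_mul]
    congr 1
    · exact Finset.sum_congr rfl fun i _ => by ring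
    · rw [Finset.sum_eq_single k]
      · simp; ring
      · intro b _ hb; simp [hb.symm]
      · simp

/-- The generator of the rotations in the coordinate plane `(i, j)`. -/
def rotGen (i j : Fin 3) :
    Derivation ℝ (MvPolynomial (Fin 3) ℝ) (MvPolynomial (Fin 3) ℝ) :=
  (X i : MvPolynomial (Fin 3) ℝ) • pderiv j - (X j : MvPolynomial (Fin 3) ℝ) • pderiv i

lemma rotGen_apply (i j : Fin 3) (p : MvPolynomial (Fin 3) ℝ) :
    rotGen i j p = X i * pderiv j p - X j * pderiv i p := by
  simp [rotGen]

lemma rotGen_self (i : Fin 3) (p : MvPolynomial (Fin 3) ℝ) : rotGen i i p = 0 := by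
  simp [rotGen_apply]

lemma restrictS2_apply (p : MvPolynomial (Fin 3) ℝ) (x : S2) :
    restrictS2 p x = eval (fun i => (x : E3) i) p := rfl

lemma restrictS2_mul (p q : MvPolynomial (Fin 3) ℝ) :
    restrictS2 (p * q) = restrictS2 p * restrictS2 q := by
  ext x; simp [restrictS2_apply]

lemma hasDerivAt_planeRotation (i j : Fin 3) (h : i ≠ j) (p : MvPolynomial (Fin 3) ℝ) (x : S2)
    (θ : ℝ) :
    HasDerivAt (fun θ => restrictS2 p (sphereMap (planeRotation i j h θ) x))
      (restrictS2 (rotGen i j p) (sphereMap (planeRotation i j h θ) x)) θ := by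
  simp only [restrictS2_apply, sphereMap, planeRotation_apply]
  have h1 := hasDerivAt_eval (t := θ)
    (v := fun θ k => if k = i then Real.cos θ * (x : E3) i - Real.sin θ * (x : E3) j
        else if k = j then Real.sin θ * (x : E3) i + Real.cos θ * (x : E3) j else (x : E3) k)
    (v' := fun k => if k = i then -Real.sin θ * (x : E3) i - Real.cos θ * (x : E3) j
        else if k = j then Real.cos θ * (x : E3) i + -Real.sin θ * (x : E3) j else 0) ?_ p
  · refine h1.congr_deriv ?_
    rw [rotGen_apply, ← Finset.sum_subset (Finset.subset_univ {i, j}), Finset.sum_pair h]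
    · simp [h.symm]
      ring
    · intro k _ hk
      simp only [Finset.mem_insert, Finset.mem_singleton, not_or] at hk
      simp [hk.1, hk.2]
  · intro k
    by_cases hi : k = i
    · simp only [hi, if_true]
      exact ((Real.hasDerivAt_cos θ).mul_const _).sub ((Real.hasDerivAt_sin θ).mul_const _)
    · by_cases hj : k = j
      · simp only [hj, if_true, if_false, h.symm]
        exact ((Real.hasDerivAt_sin θ).mul_const _).add ((Real.hasDerivAt_cos θ).mul_const _)
      · simp only [hi, hj, if_false]
        exact hasDerivAt_const _ _

lemma continuous_planeRotation (i j : Fin 3) (h : i ≠ j) :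
    Continuous fun q : ℝ × S2 => sphereMap (planeRotation i j h q.1) q.2 := by
  refine Continuous.subtype_mk ?_ _
  refine (PiLp.continuous_toLp 2 _).comp (continuous_pi fun k => ?_)
  have hc : ∀ l : Fin 3, Continuous fun q : ℝ × S2 => (q.2 : E3) l := fun l =>
    (EuclideanSpace.proj (𝕜 := ℝ) l).continuous.comp
      (continuous_subtype_val.comp continuous_snd)
  have h0 := hc i
  have h1 := hc j
  have h2 := hc k
  dsimp only
  split_ifs <;> fun_prop

/-- The integral of an infinitesimal rotation of a polynomial vanishes. -/
lemma integral_rotGen (i j : Fin 3) (p : MvPolynomial (Fin 3) ℝ) :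
    ∫ x, restrictS2 (rotGen i j p) x ∂surf = 0 := by
  rcases eq_or_ne i j with rfl | h
  · simp [rotGen_self]
  set g := restrictS2 (rotGen i j p)
  -- Integrate over all angles in two orders: rotation invariance makes the integral over the sphere
  -- independent of the angle, while along each closed orbit `g` is the derivative of a periodic
  -- function and integrates to zero.
  have h1 : ∀ θ : ℝ, ∫ x, g (sphereMap (planeRotation i j h θ) x) ∂surf = ∫ x, g x ∂surf := by
    intro θ
    have hm := measurePreserving_sphereMap (planeRotation i j h θ)
    conv_rhs => rw [← hm.map_eq]
    rw [integral_map hm.measurable.aemeasurable g.continuous.aestronglyMeasurable]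
  have h2 : ∀ x : S2, ∫ θ in (0 : ℝ)..(2 * Real.pi),
      g (sphereMap (planeRotation i j h θ) x) = 0 := by
    intro x
    rw [intervalIntegral.integral_eq_sub_of_hasDerivAt
      (fun θ _ => hasDerivAt_planeRotation i j h p x θ)]
    · rw [sub_eq_zero]
      congr 1
      ext k
      simp [sphereMap, planeRotation_apply]
    · exact (g.continuous.comp ((continuous_planeRotation i j h).comp
        (Continuous.prodMk_left x))).intervalIntegrable _ _
  have h3 : ∫ θ in (0 : ℝ)..(2 * Real.pi), ∫ x, g (sphereMap (planeRotation i j h θ) x) ∂surf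
      = ∫ x, (∫ θ in (0 : ℝ)..(2 * Real.pi), g (sphereMap (planeRotation i j h θ) x)) ∂surf := by
    apply intervalIntegral_integral_swap
    have hc : Continuous (Function.uncurry fun (θ : ℝ) (x : S2) =>
      g (sphereMap (planeRotation i j h θ) x)) := g.continuous.comp (continuous_planeRotation i j h)
    have : IsFiniteMeasure (volume.restrict (Set.uIoc 0 (2 * Real.pi))) :=
      ⟨by simp [Set.uIoc]⟩
    refine Integrable.of_bound hc.aestronglyMeasurable ‖g‖ (Eventually.of_forall fun q => ?_)
    exact g.norm_coe_le_norm _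
  simp only [h1, h2, intervalIntegral.integral_const, integral_zero, smul_eq_mul, sub_zero] at h3
  exact (mul_eq_zero.mp h3).resolve_left (by positivity)

/-- Infinitesimal rotations are antisymmetric. -/
lemma integral_rotGen_mul (i j : Fin 3) (p q : MvPolynomial (Fin 3) ℝ) :
    ∫ x, restrictS2 (rotGen i j p) x * restrictS2 q x ∂surf =
      -∫ x, restrictS2 p x * restrictS2 (rotGen i j q) x ∂surf := by
  have h := integral_rotGen i j (p * q)
  rw [Derivation.leibniz, smul_eq_mul, smul_eq_mul, map_add] at h
  simp only [ContinuousMap.add_apply] at h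
  rw [integral_add (integrable_surf _) (integrable_surf _), restrictS2_mul, restrictS2_mul] at h
  simp only [ContinuousMap.mul_apply] at h
  rw [eq_neg_iff_add_eq_zero, ← h, add_comm]
  congr 1
  exact integral_congr_ae (Eventually.of_forall fun x => mul_comm _ _)

/-- The sum of the squares of the infinitesimal rotations. -/
def casimir (p : MvPolynomial (Fin 3) ℝ) : MvPolynomial (Fin 3) ℝ :=
  rotGen 0 1 (rotGen 0 1 p) + rotGen 0 2 (rotGen 0 2 p) + rotGen 1 2 (rotGen 1 2 p)

lemma polyLaplacian_apply (p : MvPolynomial (Fin 3) ℝ) :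
    polyLaplacian p = ∑ i, pderiv i (pderiv i p) := by
  simp [polyLaplacian]

lemma pderiv_comm {σ R : Type*} [CommSemiring R] (i j : σ) (p : MvPolynomial σ R) :
    pderiv i (pderiv j p) = pderiv j (pderiv i p) := by
  classical
  rcases eq_or_ne i j with rfl | h
  · rfl
  ext m
  simp only [coeff_pderiv, add_right_comm m, Finsupp.add_apply, Finsupp.single_apply, h, h.symm,
    if_false, add_zero]
  ring

/-- This is `|x|²Δ = casimir + E(E+1)` for the Euler operator `E`, which acts on `p` as `m`. The
relations `h0`, `h1`, `h2` are the derivatives of Euler's identity; they supply the `E²` term. -/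
lemma casimir_eq {m : ℕ} {p : MvPolynomial (Fin 3) ℝ} (hp : p.IsHomogeneous m) :
    casimir p = (∑ i, X i ^ 2) * polyLaplacian p - C ((m : ℝ) * (m + 1)) * p := by
  have hE := hp.sum_X_mul_pderiv
  have hE' : ∀ k, pderiv k (∑ i, X i * pderiv i p) = pderiv k (m • p) := fun k => by rw [hE]
  have h0 := hE' 0
  have h1 := hE' 1
  have h2 := hE' 2
  simp only [Fin.sum_univ_three, map_add, pderiv_mul, nsmul_eq_mul, pderiv_X] at hE h0 h1 h2
  simp only [casimir, polyLaplacian_apply, rotGen_apply, Fin.sum_univ_three, map_sub,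
    pderiv_mul, pderiv_X]
  simp at h0 h1 h2 ⊢
  linear_combination -X 0 * h0 - X 1 * h1 - X 2 * h2 - (m + 1) * hE

end Polynomials

end

noncomputable section

/-! ### Orthogonality, spanning and dimension of spherical harmonics -/

section Harmonics

open MvPolynomial

/-- The embedding of the continuous functions on the sphere into `L²(S²)`. -/
abbrev toL2 : C(S2, ℝ) →L[ℝ] L2S2 := ContinuousMap.toLp 2 surf ℝ

lemma inner_toL2 (f g : C(S2, ℝ)) : inner ℝ (toL2 f) (toL2 g) = ∫ x, f x * g x ∂surf := by
  rw [ContinuousMap.inner_toLp]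
  simp [mul_comm]

lemma toL2_injective : Function.Injective toL2 :=
  ContinuousMap.toLp_injective surf

/-- The harmonic homogeneous polynomials of degree `m`. -/
abbrev harmPoly (m : ℕ) : Submodule ℝ (MvPolynomial (Fin 3) ℝ) :=
  homogeneousSubmodule (Fin 3) ℝ m ⊓ LinearMap.ker polyLaplacian

lemma inner_rotGen (i j : Fin 3) (p q : MvPolynomial (Fin 3) ℝ) :
    inner ℝ (toL2 (restrictS2 (rotGen i j p))) (toL2 (restrictS2 q)) =
      -inner ℝ (toL2 (restrictS2 p)) (toL2 (restrictS2 (rotGen i j q))) := by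
  rw [inner_toL2, inner_toL2, integral_rotGen_mul]

lemma inner_casimir (p q : MvPolynomial (Fin 3) ℝ) :
    inner ℝ (toL2 (restrictS2 (casimir p))) (toL2 (restrictS2 q)) =
      inner ℝ (toL2 (restrictS2 p)) (toL2 (restrictS2 (casimir q))) := by
  simp only [casimir, map_add, inner_add_left, inner_add_right, inner_rotGen, neg_neg]

lemma casimir_of_mem_harmPoly {m : ℕ} {p : MvPolynomial (Fin 3) ℝ} (hp : p ∈ harmPoly m) :
    casimir p = (-((m : ℝ) * (m + 1))) • p := by
  obtain ⟨h1, h2⟩ := Submodule.mem_inf.mp hp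
  rw [casimir_eq ((mem_homogeneousSubmodule m p).mp h1), LinearMap.mem_ker.mp h2, smul_eq_C_mul]
  simp

/-- Spherical harmonics of different degrees are orthogonal. -/
lemma inner_harmPoly_eq_zero {m k : ℕ} (hmk : m ≠ k) {p q : MvPolynomial (Fin 3) ℝ}
    (hp : p ∈ harmPoly m) (hq : q ∈ harmPoly k) :
    inner ℝ (toL2 (restrictS2 p)) (toL2 (restrictS2 q)) = 0 := by
  have h := inner_casimir p q
  rw [casimir_of_mem_harmPoly hp, casimir_of_mem_harmPoly hq] at h
  simp only [map_smul, inner_smul_left, inner_smul_right, conj_trivial] at h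
  -- The difference of the eigenvalues, `m(m+1) - k(k+1)`, factors as `(m-k)(m+k+1)`.
  have h2 : ((m : ℝ) - k) * (m + k + 1) *
      inner ℝ (toL2 (restrictS2 p)) (toL2 (restrictS2 q)) = 0 := by
    linear_combination -h
  rcases mul_eq_zero.mp h2 with h3 | h3
  · rcases mul_eq_zero.mp h3 with h4 | h4
    · exact absurd (by exact_mod_cast sub_eq_zero.mp h4) hmk
    · exact absurd h4 (by positivity)
  · exact h3

lemma restrictS2_sq_mul (p : MvPolynomial (Fin 3) ℝ) :
    restrictS2 ((∑ i, X i ^ 2) * p) = restrictS2 p := by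
  ext x
  have h : ‖(x : E3)‖ ^ 2 = 1 := by simp
  rw [EuclideanSpace.norm_sq_eq] at h
  simp only [Real.norm_eq_abs, sq_abs] at h
  simp [restrictS2_apply, h]

lemma exists_smul_sphere (v : E3) : ∃ (c : ℝ) (x : S2), v = c • (x : E3) := by
  rcases eq_or_ne v 0 with rfl | hv
  · obtain ⟨x, hx⟩ := (NormedSpace.sphere_nonempty (x := (0 : E3)) (r := 1)).mpr zero_le_one
    exact ⟨0, ⟨x, hx⟩, by simp⟩
  · exact ⟨‖v‖, ⟨‖v‖⁻¹ • v, by simp [norm_smul, hv]⟩, by simp [smul_smul, hv]⟩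

lemma eval_mul_of_isHomogeneous {σ : Type*} [Fintype σ] {m : ℕ} {p : MvPolynomial σ ℝ}
    (hp : p.IsHomogeneous m) (c : ℝ) (v : σ → ℝ) :
    eval (fun i => c * v i) p = c ^ m * eval v p := by
  rw [eval_eq', eval_eq', Finset.mul_sum]
  refine Finset.sum_congr rfl fun d hd => ?_
  have h : ∑ i, d i = m := by
    rw [← Finsupp.degree_eq_sum, Finsupp.degree_eq_weight_one]
    exact hp (mem_support_iff.mp hd)
  simp only [mul_pow, Finset.prod_mul_distrib, Finset.prod_pow_eq_pow_sum, h]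
  ring

lemma eq_zero_of_restrictS2_eq_zero {m : ℕ} {p : MvPolynomial (Fin 3) ℝ}
    (hp : p.IsHomogeneous m) (h : restrictS2 p = 0) : p = 0 := by
  apply MvPolynomial.funext
  intro v
  obtain ⟨c, x, hx⟩ := exists_smul_sphere (WithLp.toLp 2 v)
  have hv : v = fun i => c * (x : E3) i := by
    ext i
    exact congrArg (fun w : E3 => w i) hx
  have h1 : eval (fun i => (x : E3) i) p = 0 := congrArg (fun g : C(S2, ℝ) => g x) h
  rw [hv, eval_mul_of_isHomogeneous hp, h1, mul_zero, map_zero]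

lemma polyLaplacian_isHomogeneous {m : ℕ} {p : MvPolynomial (Fin 3) ℝ}
    (hp : p.IsHomogeneous (m + 2)) : (polyLaplacian p).IsHomogeneous m := by
  rw [polyLaplacian_apply]
  exact IsHomogeneous.sum _ _ _ fun i _ => hp.pderiv.pderiv

lemma polyLaplacian_eq_zero {m : ℕ} (hm : m ≤ 1) {p : MvPolynomial (Fin 3) ℝ}
    (hp : p.IsHomogeneous m) : polyLaplacian p = 0 := by
  rw [polyLaplacian_apply]
  refine Finset.sum_eq_zero fun i _ => ?_
  -- Truncated subtraction turns `m - 1` into `0` for both `m = 0` and `m = 1`.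
  have h : (pderiv i p).IsHomogeneous 0 := by
    have := hp.pderiv (i := i)
    rwa [Nat.sub_eq_zero_of_le hm] at this
  rw [← totalDegree_zero_iff_isHomogeneous, totalDegree_eq_zero_iff_eq_C] at h
  rw [h, pderiv_C]

lemma isHomogeneous_sum_sq : (∑ i : Fin 3, (X i : MvPolynomial (Fin 3) ℝ) ^ 2).IsHomogeneous 2 :=
  IsHomogeneous.sum _ _ _ fun i _ => isHomogeneous_X_pow i 2

/-- The map `q ↦ Δ(|x|² q)` on homogeneous polynomials. -/
def laplacianSq (k : ℕ) :
    homogeneousSubmodule (Fin 3) ℝ k →ₗ[ℝ] homogeneousSubmodule (Fin 3) ℝ k where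
  toFun q := ⟨polyLaplacian ((∑ i, X i ^ 2) * (q : MvPolynomial (Fin 3) ℝ)), (mem_homogeneousSubmodule _ _).mpr <|
    polyLaplacian_isHomogeneous <| by
      rw [add_comm]
      exact isHomogeneous_sum_sq.mul ((mem_homogeneousSubmodule _ _).mp q.2)⟩
  map_add' p q := by ext1; simp [mul_add]
  map_smul' c p := by ext1; simp

/-- If `g` is orthogonal to all spherical harmonics of the degrees in `s`, it is orthogonal to
their sums. -/
lemma inner_eq_zero_of_mem_iSup {s : Set ℕ} {g : L2S2} {h : C(S2, ℝ)}
    (hg : ∀ j ∈ s, ∀ q ∈ harmPoly j, inner ℝ g (toL2 (restrictS2 q)) = 0)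
    (hh : h ∈ ⨆ j ∈ s, sphHarm j) : inner ℝ g (toL2 h) = 0 := by
  have hle : ⨆ j ∈ s, sphHarm j ≤ LinearMap.ker ((innerSL ℝ g).comp toL2).toLinearMap := by
    refine iSup₂_le fun j hj => ?_
    rintro _ ⟨q, hq, rfl⟩
    exact hg j hj q hq
  exact hle hh

/-- On the sphere, each homogeneous polynomial is a sum of spherical harmonics. -/
lemma restrictS2_mem_iSup (k : ℕ) : ∀ p : MvPolynomial (Fin 3) ℝ, p.IsHomogeneous k →
    restrictS2 p ∈ ⨆ j ∈ Set.Iic k, sphHarm j := by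
  induction k using Nat.strong_induction_on with
  | _ k ih =>
  intro p hp
  have hharm : ∀ q ∈ harmPoly k, restrictS2 q ∈ ⨆ j ∈ Set.Iic k, sphHarm j := fun q hq =>
    Submodule.mem_iSup_of_mem k (Submodule.mem_iSup_of_mem (Set.mem_Iic.mpr le_rfl) ⟨q, hq, rfl⟩)
  rcases Nat.lt_or_ge 1 k with hk | hk
  · obtain ⟨l, rfl⟩ : ∃ l, k = l + 2 := ⟨k - 2, by omega⟩
    have : FiniteDimensional ℝ (homogeneousSubmodule (Fin 3) ℝ l) :=
      Module.Finite.iff_fg.mpr (homogeneousSubmodule_fg (σ := Fin 3) (R := ℝ) l)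
    -- If `|x|²q` is harmonic of degree `l+2`, it is orthogonal to all harmonics of degree at most
    -- `l`. By induction `q`, which equals `|x|²q` on the sphere, is a sum of such harmonics, hence
    -- orthogonal to itself. In finite dimension injectivity gives surjectivity, and thus a `q` for
    -- which `p - |x|²q` is harmonic.
    have hinj : Function.Injective (laplacianSq l) := by
      rw [injective_iff_map_eq_zero]
      rintro ⟨q, hq⟩ h0
      have hqh := (mem_homogeneousSubmodule _ _).mp hq
      have h0' : polyLaplacian ((∑ i, X i ^ 2) * q) = 0 := congrArg Subtype.val h0
      have hmem : (∑ i, X i ^ 2) * q ∈ harmPoly (l + 2) := by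
        refine ⟨(mem_homogeneousSubmodule _ _).mpr ?_, h0'⟩
        rw [add_comm]
        exact isHomogeneous_sum_sq.mul hqh
      have hself : inner ℝ (toL2 (restrictS2 q)) (toL2 (restrictS2 q)) = 0 := by
        refine inner_eq_zero_of_mem_iSup (fun j hj r hr => ?_) (ih l (by omega) q hqh)
        rw [← restrictS2_sq_mul q]
        refine inner_harmPoly_eq_zero ?_ hmem hr
        have : j ≤ l := hj
        omega
      rw [inner_self_eq_zero, map_eq_zero_iff _ toL2_injective] at hself
      exact Subtype.ext (eq_zero_of_restrictS2_eq_zero hqh hself)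
    obtain ⟨⟨q, hq⟩, hqp⟩ := (LinearMap.injective_iff_surjective.mp hinj)
      ⟨polyLaplacian p, (mem_homogeneousSubmodule _ _).mpr (polyLaplacian_isHomogeneous hp)⟩
    have hqh := (mem_homogeneousSubmodule _ _).mp hq
    have hqp' : polyLaplacian ((∑ i, X i ^ 2) * q) = polyLaplacian p := congrArg Subtype.val hqp
    have h1 : restrictS2 (p - (∑ i, X i ^ 2) * q) ∈ ⨆ j ∈ Set.Iic (l + 2), sphHarm j := by
      refine hharm _ ⟨(homogeneousSubmodule (Fin 3) ℝ (l + 2)).sub_mem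
        ((mem_homogeneousSubmodule _ _).mpr hp) ((mem_homogeneousSubmodule _ _).mpr ?_), ?_⟩
      · rw [add_comm]
        exact isHomogeneous_sum_sq.mul hqh
      · simp [hqp']
    have hle : ⨆ j ∈ Set.Iic l, sphHarm j ≤ ⨆ j ∈ Set.Iic (l + 2), sphHarm j :=
      biSup_mono fun j (hj : j ≤ l) => (show j ≤ l + 2 by omega)
    have h2 := hle (ih l (by omega) q hqh)
    rw [map_sub, restrictS2_sq_mul] at h1
    simpa using Submodule.add_mem _ h1 h2
  · exact hharm p ⟨(mem_homogeneousSubmodule _ _).mpr hp, polyLaplacian_eq_zero hk hp⟩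

lemma restrictS2_mem_iSup_univ (p : MvPolynomial (Fin 3) ℝ) :
    restrictS2 p ∈ ⨆ j ∈ (Set.univ : Set ℕ), sphHarm j := by
  rw [← sum_homogeneousComponent p, map_sum]
  refine Submodule.sum_mem _ fun k _ => ?_
  have hle : ⨆ j ∈ Set.Iic k, sphHarm j ≤ ⨆ j ∈ (Set.univ : Set ℕ), sphHarm j :=
    biSup_mono fun _ _ => Set.mem_univ _
  exact hle (restrictS2_mem_iSup k _ (homogeneousComponent_isHomogeneous k p))

/-- The exponent of the monomial `x^a y^b z^c`. -/
def expo (a b c : ℕ) : Fin 3 →₀ ℕ := Finsupp.equivFunOnFinite.symm ![a, b, c]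

lemma expo_apply (a b c : ℕ) (i : Fin 3) : expo a b c i = ![a, b, c] i := rfl

lemma eq_expo (d : Fin 3 →₀ ℕ) : d = expo (d 0) (d 1) (d 2) := by
  ext i; fin_cases i <;> simp [expo]

/-- The coefficients of the monomials `x^a y^b` and `x^a y^b z`. -/
def lowCoeffs (m : ℕ) : MvPolynomial (Fin 3) ℝ →ₗ[ℝ] (Fin (m + 1) ⊕ Fin m → ℝ) where
  toFun p := Sum.elim (fun i => coeff (expo i (m - i) 0) p)
    (fun i => coeff (expo i (m - 1 - i) 1) p)
  map_add' p q := by ext i; rcases i with i | i <;> simp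
  map_smul' c p := by ext i; rcases i with i | i <;> simp

/-- A harmonic homogeneous polynomial is determined by its coefficients of degree at most one
in the last variable. -/
lemma eq_zero_of_lowCoeffs_eq_zero {m : ℕ} {p : MvPolynomial (Fin 3) ℝ} (hp : p ∈ harmPoly m)
    (h : lowCoeffs m p = 0) : p = 0 := by
  obtain ⟨h1, h2⟩ := Submodule.mem_inf.mp hp
  rw [mem_homogeneousSubmodule] at h1
  rw [LinearMap.mem_ker] at h2
  have hdeg : ∀ d : Fin 3 →₀ ℕ, d 0 + d 1 + d 2 ≠ m → coeff d p = 0 := by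
    intro d hd
    apply h1.coeff_eq_zero
    rwa [Finsupp.degree_eq_sum, Fin.sum_univ_three]
  have key : ∀ n : ℕ, ∀ d : Fin 3 →₀ ℕ, d 2 = n → coeff d p = 0 := by
    intro n
    induction n using Nat.strong_induction_on with
    | _ n ih =>
    intro d hd
    by_cases hs : d 0 + d 1 + d 2 = m
    swap
    · exact hdeg d hs
    match n, hd with
    | 0, hd =>
      have := congrFun h (Sum.inl ⟨d 0, by omega⟩)
      have h3 : m - d 0 = d 1 := by omega
      rw [eq_expo d, hd]
      simpa [lowCoeffs, h3] using this
    | 1, hd =>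
      have := congrFun h (Sum.inr ⟨d 0, by omega⟩)
      have h3 : m - 1 - d 0 = d 1 := by omega
      rw [eq_expo d, hd]
      simpa [lowCoeffs, h3] using this
    | n + 2, hd =>
      -- This coefficient of `Δp = 0` expresses the coefficient with exponent `n+2` in the last
      -- variable through two coefficients with exponent `n` there.
      have h3 := congrArg (coeff (expo (d 0) (d 1) n)) h2
      simp only [polyLaplacian_apply, Fin.sum_univ_three, coeff_add, coeff_pderiv,
        coeff_zero] at h3
      rw [ih n (by omega) (expo (d 0) (d 1) n + Finsupp.single 0 1 + Finsupp.single 0 1)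
          (by simp [expo_apply]),
        ih n (by omega) (expo (d 0) (d 1) n + Finsupp.single 1 1 + Finsupp.single 1 1)
          (by simp [expo_apply])] at h3
      have h4 : expo (d 0) (d 1) n + Finsupp.single 2 1 + Finsupp.single 2 1 = d := by
        ext i; fin_cases i <;> simp [expo_apply, hd]
      rw [h4] at h3
      simp only [zero_mul, zero_add] at h3
      rcases mul_eq_zero.mp h3 with h5 | h5
      · rcases mul_eq_zero.mp h5 with h6 | h6
        · exact h6
        · exact absurd h6 (by positivity)
      · exact absurd h5 (by positivity)
  ext d
  exact key (d 2) d rfl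

/-- There are `m+1` monomials of degree `m` free of the last variable and `m` linear in it. The
upper bound suffices for the kernel estimates. -/
lemma finrank_sphHarmL2_le (m : ℕ) : Module.finrank ℝ (sphHarmL2 m) ≤ 2 * m + 1 := by
  have hinj : Function.Injective ((lowCoeffs m).domRestrict (harmPoly m)) := by
    rw [injective_iff_map_eq_zero]
    rintro ⟨p, hp⟩ h
    exact Subtype.ext (eq_zero_of_lowCoeffs_eq_zero hp h)
  have hfin : FiniteDimensional ℝ (harmPoly m) := Module.Finite.of_injective _ hinj
  have h1 := LinearMap.finrank_le_finrank_of_injective hinj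
  have h2 : Module.finrank ℝ (sphHarmL2 m) ≤ Module.finrank ℝ (harmPoly m) := by
    unfold sphHarmL2 sphHarm
    exact (Submodule.finrank_map_le _ _).trans (Submodule.finrank_map_le _ _)
  simp only [Module.finrank_fintype_fun_eq_card, Fintype.card_sum, Fintype.card_fin] at h1
  omega

end Harmonics

end

noncomputable section

/-! ### The addition theorem and the reproducing kernel -/

section Kernel

open MvPolynomial

lemma polyLaplacian_X_mul (i : Fin 3) (q : MvPolynomial (Fin 3) ℝ) :
    polyLaplacian (X i * q) = X i * polyLaplacian q + 2 * pderiv i q := by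
  simp only [polyLaplacian_apply, pderiv_mul, pderiv_X, map_add, Fin.sum_univ_three]
  fin_cases i <;> simp <;> ring

lemma polyLaplacian_pderiv (i : Fin 3) (q : MvPolynomial (Fin 3) ℝ) :
    polyLaplacian (pderiv i q) = pderiv i (polyLaplacian q) := by
  simp only [polyLaplacian_apply, map_sum]
  exact Finset.sum_congr rfl fun j _ => by rw [pderiv_comm j i, pderiv_comm j i]

/-- The Laplacian commutes with rotation generators: moving it past `X i` produces `2∂_i`, and the
two resulting terms `2∂_i∂_j` cancel. -/
lemma rotGen_mem_harmPoly {m : ℕ} (i j : Fin 3) {p : MvPolynomial (Fin 3) ℝ}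
    (hp : p ∈ harmPoly m) : rotGen i j p ∈ harmPoly m := by
  obtain ⟨h1, h2⟩ := Submodule.mem_inf.mp hp
  rw [mem_homogeneousSubmodule] at h1
  rw [LinearMap.mem_ker] at h2
  have key : ∀ i j : Fin 3, (X i * pderiv j p).IsHomogeneous m := by
    intro i j
    rcases Nat.eq_zero_or_pos m with rfl | hm
    · rw [← totalDegree_zero_iff_isHomogeneous, totalDegree_eq_zero_iff_eq_C] at h1
      rw [h1, pderiv_C, mul_zero]
      exact isHomogeneous_zero _ _ _
    · have h := (isHomogeneous_X ℝ i).mul (h1.pderiv (i := j))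
      rwa [show 1 + (m - 1) = m by omega] at h
  refine ⟨?_, ?_⟩
  · rw [rotGen_apply]
    exact (homogeneousSubmodule (Fin 3) ℝ m).sub_mem ((mem_homogeneousSubmodule _ _).mpr (key i j))
      ((mem_homogeneousSubmodule _ _).mpr (key j i))
  · change polyLaplacian _ = 0
    rw [rotGen_apply, map_sub, polyLaplacian_X_mul, polyLaplacian_X_mul, polyLaplacian_pderiv,
      polyLaplacian_pderiv, h2, map_zero, map_zero, pderiv_comm i j]
    simp

/-- A polynomial invariant under infinitesimal rotations is constant on the sphere. -/
lemma restrictS2_eq_const {F : MvPolynomial (Fin 3) ℝ}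
    (hF : ∀ i j, restrictS2 (rotGen i j F) = 0) (x : S2) :
    restrictS2 F x = (4 * Real.pi)⁻¹ * ∫ y, restrictS2 F y ∂surf := by
  set c := (4 * Real.pi)⁻¹ * ∫ y, restrictS2 F y ∂surf with hc
  have hCmem : ∀ a : ℝ, (C a : MvPolynomial (Fin 3) ℝ) ∈ harmPoly 0 := fun a =>
    ⟨(mem_homogeneousSubmodule _ _).mpr (isHomogeneous_C _ a),
      polyLaplacian_eq_zero zero_le_one (isHomogeneous_C _ a)⟩
  have hCval : ∀ (a : ℝ) (y : S2), restrictS2 (C a) y = a := fun a y => by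
    simp [restrictS2_apply]
  -- In degree `0` orthogonality holds because `c` is the mean of `F`. In degree `j > 0`, `q` is a
  -- nonzero multiple of `casimir q`, whose generators can be moved onto `F`, where they vanish.
  -- Since `F - C c` is itself a sum of harmonics on the sphere, it must be zero there.
  have horth : ∀ j ∈ (Set.univ : Set ℕ), ∀ q ∈ harmPoly j,
      inner ℝ (toL2 (restrictS2 (F - C c))) (toL2 (restrictS2 q)) = 0 := by
    intro j _ q hq
    rcases Nat.eq_zero_or_pos j with rfl | hj
    · have h1 := (mem_homogeneousSubmodule _ _).mp (Submodule.mem_inf.mp hq).1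
      rw [← totalDegree_zero_iff_isHomogeneous, totalDegree_eq_zero_iff_eq_C] at h1
      rw [h1, inner_toL2]
      simp only [hCval, map_sub, ContinuousMap.sub_apply]
      rw [integral_mul_const, integral_sub (integrable_surf _) (integrable_const _),
        integral_const, surf_real_univ, smul_eq_mul, hc]
      field_simp
      simp
    · rw [map_sub, map_sub, inner_sub_left, inner_harmPoly_eq_zero hj.ne (hCmem c) hq, sub_zero]
      have h1 : inner ℝ (toL2 (restrictS2 F)) (toL2 (restrictS2 (casimir q))) = 0 := by
        have h : ∀ i j, inner ℝ (toL2 (restrictS2 F)) (toL2 (restrictS2 (rotGen i j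
            (rotGen i j q)))) = 0 := fun i j => by
          rw [← neg_eq_zero, ← inner_rotGen, hF, map_zero, inner_zero_left]
        simp only [casimir, map_add, inner_add_right, h, add_zero]
      rw [casimir_of_mem_harmPoly hq, map_smul, map_smul, inner_smul_right] at h1
      exact (mul_eq_zero.mp h1).resolve_left (by
        refine neg_ne_zero.mpr ?_
        have : (0 : ℝ) < j := by exact_mod_cast hj
        positivity)
  have h0 := inner_eq_zero_of_mem_iSup horth (restrictS2_mem_iSup_univ (F - C c))
  rw [inner_self_eq_zero, map_eq_zero_iff _ toL2_injective] at h0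
  have h1 := congrArg (fun g : C(S2, ℝ) => g x) h0
  simp only [map_sub, ContinuousMap.sub_apply, hCval, ContinuousMap.zero_apply] at h1
  linarith

lemma exists_harmPoly (m : ℕ) (v : sphHarmL2 m) :
    ∃ p ∈ harmPoly m, toL2 (restrictS2 p) = v := by
  obtain ⟨_, ⟨p, hp, rfl⟩, h⟩ := v.2
  exact ⟨p, hp, h⟩

lemma toL2_mem_sphHarmL2 {m : ℕ} {p : MvPolynomial (Fin 3) ℝ} (hp : p ∈ harmPoly m) :
    toL2 (restrictS2 p) ∈ sphHarmL2 m :=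
  ⟨_, ⟨p, hp, rfl⟩, rfl⟩

/-- The sum of the squares of an orthonormal basis of the spherical harmonics of degree `m` is
constant. -/
lemma sum_sq_orthonormalBasis {m : ℕ} {ι : Type*} [Fintype ι]
    (b : OrthonormalBasis ι ℝ (sphHarmL2 m)) (p : ι → MvPolynomial (Fin 3) ℝ)
    (hp : ∀ k, p k ∈ harmPoly m) (hb : ∀ k, toL2 (restrictS2 (p k)) = b k) (x : S2) :
    ∑ k, restrictS2 (p k) x ^ 2 = Fintype.card ι / (4 * Real.pi) := by
  have hL : ∀ i j k, restrictS2 (rotGen i j (p k)) =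
      ∑ l, inner ℝ (toL2 (restrictS2 (p l))) (toL2 (restrictS2 (rotGen i j (p k)))) •
        restrictS2 (p l) := by
    intro i j k
    apply toL2_injective
    have h := b.sum_repr' ⟨_, toL2_mem_sphHarmL2 (rotGen_mem_harmPoly i j (hp k))⟩
    have h' := congrArg (Subtype.val) h
    simp only [Submodule.coe_sum, Submodule.coe_smul, Submodule.coe_inner, ← hb] at h'
    rw [map_sum]
    simp only [map_smul]
    exact h'.symm
  -- A generator acts on the basis by the antisymmetric matrix `c`; differentiating the sum of
  -- squares pairs `c` with a symmetric matrix.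
  have hF : ∀ i j, restrictS2 (rotGen i j (∑ k, p k ^ 2)) = 0 := by
    intro i j
    ext y
    have h1 : restrictS2 (rotGen i j (∑ k, p k ^ 2)) y =
        ∑ k, 2 * (restrictS2 (p k) y * restrictS2 (rotGen i j (p k)) y) := by
      simp only [map_sum, ContinuousMap.coe_sum, Finset.sum_apply]
      refine Finset.sum_congr rfl fun k _ => ?_
      rw [pow_two, Derivation.leibniz, smul_eq_mul, map_add, restrictS2_mul]
      simp only [ContinuousMap.add_apply, ContinuousMap.mul_apply]
      ring
    set c : ι → ι → ℝ := fun l k =>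
      inner ℝ (toL2 (restrictS2 (p l))) (toL2 (restrictS2 (rotGen i j (p k)))) with hc
    have hanti : ∀ l k, c l k = -c k l := fun l k => by
      simp only [hc]
      rw [real_inner_comm, inner_rotGen]
    have h2 : ∀ k, restrictS2 (rotGen i j (p k)) y = ∑ l, c l k * restrictS2 (p l) y := by
      intro k
      have h := congrArg (fun g : C(S2, ℝ) => g y) (hL i j k)
      simpa [ContinuousMap.coe_sum] using h
    have h3 : ∑ k, ∑ l, c l k * (restrictS2 (p k) y * restrictS2 (p l) y) = 0 := by
      have h4 : ∑ k, ∑ l, c l k * (restrictS2 (p k) y * restrictS2 (p l) y) =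
          -∑ k, ∑ l, c l k * (restrictS2 (p k) y * restrictS2 (p l) y) := by
        conv_lhs => rw [Finset.sum_comm]
        simp only [← Finset.sum_neg_distrib]
        refine Finset.sum_congr rfl fun k _ => Finset.sum_congr rfl fun l _ => ?_
        rw [hanti k l]
        ring
      linarith
    have h5 : ∑ k, ∑ l, 2 * (restrictS2 (p k) y * (c l k * restrictS2 (p l) y)) =
        2 * ∑ k, ∑ l, c l k * (restrictS2 (p k) y * restrictS2 (p l) y) := by
      simp only [Finset.mul_sum]
      exact Finset.sum_congr rfl fun k _ => Finset.sum_congr rfl fun l _ => by ring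
    simp only [h1, h2, Finset.mul_sum]
    rw [h5, h3, mul_zero]
    rfl
  have hval : ∀ y, restrictS2 (∑ k, p k ^ 2) y = ∑ k, restrictS2 (p k) y ^ 2 := fun y => by
    simp [restrictS2_apply]
  have h := restrictS2_eq_const hF x
  simp only [hval] at h
  rw [h, integral_finsetSum _ fun k _ => ?_]
  · have h1 : ∀ k, ∫ y, restrictS2 (p k) y ^ 2 ∂surf = 1 := by
      intro k
      have h2 : inner ℝ (toL2 (restrictS2 (p k))) (toL2 (restrictS2 (p k))) = 1 := by
        rw [hb, ← Submodule.coe_inner, real_inner_self_eq_norm_sq, b.orthonormal.1 k, one_pow]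
      rw [inner_toL2] at h2
      simpa only [pow_two] using h2
    simp [h1]
    ring
  · exact integrable_surf (restrictS2 (p k) ^ 2)

/-- The reproducing kernel of the spherical harmonics of degree `m`. -/
lemma exists_reproducingKernel (m : ℕ) (x : S2) :
    ∃ k : C(S2, ℝ), toL2 k ∈ sphHarmL2 m ∧
      (∀ q ∈ harmPoly m, restrictS2 q x = inner ℝ (toL2 k) (toL2 (restrictS2 q))) ∧
      (∀ y, |k y| ≤ (2 * m + 1) / (4 * Real.pi)) ∧
      ‖toL2 k‖ ^ 2 ≤ (2 * m + 1) / (4 * Real.pi) := by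
  set b := stdOrthonormalBasis ℝ (sphHarmL2 m)
  choose p hp hb using fun i => exists_harmPoly m (b i)
  have hdim : (Module.finrank ℝ (sphHarmL2 m) : ℝ) / (4 * Real.pi) ≤
      (2 * m + 1) / (4 * Real.pi) := by
    gcongr
    exact_mod_cast finrank_sphHarmL2_le m
  have hsum : ∀ y : S2, ∑ i, restrictS2 (p i) y ^ 2 ≤ (2 * m + 1) / (4 * Real.pi) := by
    intro y
    rw [sum_sq_orthonormalBasis b p hp hb y, Fintype.card_fin]
    exact hdim
  have hrep : ∀ q ∈ harmPoly m, restrictS2 q x =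
      inner ℝ (toL2 (∑ i, restrictS2 (p i) x • restrictS2 (p i))) (toL2 (restrictS2 q)) := by
    intro q hq
    have h := congrArg Subtype.val (b.sum_repr' ⟨_, toL2_mem_sphHarmL2 hq⟩)
    simp only [Submodule.coe_sum, Submodule.coe_smul, Submodule.coe_inner, ← hb] at h
    have h2 : ∑ i, inner ℝ (toL2 (restrictS2 (p i))) (toL2 (restrictS2 q)) • restrictS2 (p i) =
        restrictS2 q := by
      apply toL2_injective
      rw [map_sum]
      simp only [map_smul]
      exact h
    have h3 := congrArg (fun g : C(S2, ℝ) => g x) h2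
    simp only [ContinuousMap.coe_sum, Finset.sum_apply, ContinuousMap.coe_smul,
      Pi.smul_apply, smul_eq_mul] at h3
    rw [← h3, map_sum, sum_inner]
    simp only [map_smul, inner_smul_left, conj_trivial]
    exact Finset.sum_congr rfl fun i _ => mul_comm _ _
  have hmem : ∑ i, restrictS2 (p i) x • p i ∈ harmPoly m :=
    Submodule.sum_mem _ fun i _ => Submodule.smul_mem _ _ (hp i)
  have hk : ∑ i, restrictS2 (p i) x • restrictS2 (p i) =
      restrictS2 (∑ i, restrictS2 (p i) x • p i) := by simp
  refine ⟨∑ i, restrictS2 (p i) x • restrictS2 (p i), ?_, hrep, ?_, ?_⟩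
  · rw [hk]
    exact toL2_mem_sphHarmL2 hmem
  · intro y
    simp only [ContinuousMap.coe_sum, Finset.sum_apply, ContinuousMap.coe_smul,
      Pi.smul_apply, smul_eq_mul]
    -- Cauchy–Schwarz over the basis index, with the sum of squares known at both `x` and `y`.
    apply abs_le_of_sq_le_sq _ (by positivity)
    refine (Finset.sum_mul_sq_le_sq_mul_sq _ _ _).trans ?_
    rw [pow_two]
    exact mul_le_mul (hsum x) (hsum y) (Finset.sum_nonneg fun _ _ => sq_nonneg _) (by positivity)
  -- The reproducing property applied to the kernel itself turns its squared norm into its value at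
  -- `x`.
  · rw [← real_inner_self_eq_norm_sq]
    conv_lhs => rw [hk]
    have h := hrep _ hmem
    rw [hk] at h
    rw [← h]
    refine le_trans (le_of_eq ?_) (hsum x)
    simp [restrictS2_apply, pow_two]

end Kernel

end

noncomputable section

/-! ### Spectral expansion of the operator and its continuous representative -/

section Operator

open MvPolynomial

lemma inner_sphHarmL2_eq_zero {m k : ℕ} (hmk : m ≠ k) {u v : L2S2} (hu : u ∈ sphHarmL2 m)
    (hv : v ∈ sphHarmL2 k) : inner ℝ u v = 0 := by
  obtain ⟨p, hp, rfl⟩ := exists_harmPoly m ⟨u, hu⟩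
  obtain ⟨q, hq, rfl⟩ := exists_harmPoly k ⟨v, hv⟩
  exact inner_harmPoly_eq_zero hmk hp hq

/-- Polynomials are dense in the continuous functions on the sphere. -/
lemma dense_range_restrictS2 : Dense (Set.range restrictS2) := by
  let φ : MvPolynomial (Fin 3) ℝ →ₐ[ℝ] C(S2, ℝ) :=
    { toFun := restrictS2
      map_one' := by ext; simp [restrictS2_apply]
      map_zero' := map_zero _
      map_mul' := restrictS2_mul
      map_add' := map_add _
      commutes' := fun r => by
        ext; simp [restrictS2_apply, MvPolynomial.algebraMap_eq] }
  have hsep : φ.range.SeparatesPoints := by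
    intro x y hxy
    obtain ⟨i, hi⟩ : ∃ i, (x : E3) i ≠ (y : E3) i := by
      by_contra! h
      exact hxy (Subtype.ext (PiLp.ext h))
    refine ⟨_, ⟨φ (X i), ⟨X i, rfl⟩, rfl⟩, ?_⟩
    change restrictS2 (X i) x ≠ restrictS2 (X i) y
    simpa [restrictS2_apply] using hi
  have h := ContinuousMap.subalgebra_topologicalClosure_eq_top_of_separatesPoints φ.range hsep
  rw [dense_iff_closure_eq]
  exact congrArg (fun A : Subalgebra ℝ C(S2, ℝ) => (A : Set C(S2, ℝ))) h

/-- A function orthogonal to all harmonics is orthogonal to polynomials, hence by density to `C(S²)`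
and then to `L²`. -/
lemma iSup_sphHarmL2_topologicalClosure : (⨆ m, sphHarmL2 m).topologicalClosure = ⊤ := by
  rw [Submodule.topologicalClosure_eq_top_iff, Submodule.eq_bot_iff]
  intro u hu
  have h1 : ∀ p, inner ℝ u (toL2 (restrictS2 p)) = 0 := fun p =>
    inner_eq_zero_of_mem_iSup (fun j _ q hq => by
      rw [real_inner_comm]
      exact (Submodule.mem_orthogonal _ _).mp hu _
        (Submodule.mem_iSup_of_mem j (toL2_mem_sphHarmL2 hq))) (restrictS2_mem_iSup_univ p)
  have h2 : ∀ g : C(S2, ℝ), inner ℝ u (toL2 g) = 0 := fun g =>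
    congrFun (Continuous.ext_on (f := fun g => inner ℝ u (toL2 g))
      (g := fun _ => (0 : ℝ)) dense_range_restrictS2 (by fun_prop) continuous_const
      (by rintro _ ⟨p, rfl⟩; exact h1 p)) g
  have h3 : ∀ v : L2S2, inner ℝ u v = 0 := fun v =>
    congrFun (Continuous.ext_on (f := fun v : L2S2 => inner ℝ u v) (g := fun _ => (0 : ℝ))
      (ContinuousMap.toLp_denseRange ℝ surf ℝ (p := 2) (by simp)) (by fun_prop) continuous_const
      (by rintro _ ⟨g, rfl⟩; exact h2 g)) v
  exact inner_self_eq_zero.mp (h3 u)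

lemma Qproj_mem (m : ℕ) (u : L2S2) : Qproj m u ∈ sphHarmL2 m :=
  Submodule.starProjection_apply_mem _ _

lemma Qproj_of_mem {m : ℕ} {u : L2S2} (hu : u ∈ sphHarmL2 m) : Qproj m u = u :=
  Submodule.starProjection_eq_self_iff.mpr hu

lemma inner_Qproj_left (m : ℕ) (u v : L2S2) : inner ℝ (Qproj m u) v = inner ℝ u (Qproj m v) :=
  Submodule.inner_starProjection_left_eq_right _ _ _

lemma Qproj_of_mem_of_ne {m k : ℕ} (h : m ≠ k) {u : L2S2} (hu : u ∈ sphHarmL2 k) :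
    Qproj m u = 0 := by
  rw [← inner_self_eq_zero (𝕜 := ℝ), inner_Qproj_left, Qproj_of_mem (Qproj_mem m u)]
  exact inner_sphHarmL2_eq_zero h.symm hu (Qproj_mem m u)

lemma norm_Qproj_le (m : ℕ) (u : L2S2) : ‖Qproj m u‖ ≤ ‖u‖ :=
  Submodule.norm_starProjection_apply_le _ _

/-- Completeness of the spherical harmonics. -/
lemma hasSum_Qproj (u : L2S2) : HasSum (fun m => Qproj m u) u := by
  have hV : OrthogonalFamily ℝ (fun m => sphHarmL2 m) fun m => (sphHarmL2 m).subtypeₗᵢ :=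
    fun m k hmk v w => inner_sphHarmL2_eq_zero hmk v.2 w.2
  have hS := IsHilbertSum.mkInternal (𝕜 := ℝ) sphHarmL2 hV
    iSup_sphHarmL2_topologicalClosure.ge
  have h := hS.hasSum_linearIsometryEquiv_symm (hS.linearIsometryEquiv u)
  rw [LinearIsometryEquiv.symm_apply_apply] at h
  convert h using 2 with m
  -- Applying `Qproj m` to the Hilbert sum kills all components but the `m`-th and so identifies
  -- that one.
  have h1 := h.mapL (Qproj m)
  refine h1.unique ?_
  have h2 := hasSum_single (f := fun k => Qproj m (hS.linearIsometryEquiv u k : L2S2)) m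
    fun k hk => ?_
  · rw [Qproj_of_mem (hS.linearIsometryEquiv u m).2] at h2
    exact h2
  exact Qproj_of_mem_of_ne hk.symm (hS.linearIsometryEquiv u k).2

/-- The eigenvalues of the gradiometry operator. -/
def gradCoeff (R : ℝ) (m : ℕ) : ℝ := ((m : ℝ) + 1) * ((m : ℝ) + 2) / R ^ (m + 3)

lemma gradCoeff_pos {R : ℝ} (hR : 1 < R) (m : ℕ) : 0 < gradCoeff R m := by
  unfold gradCoeff; positivity

/-- `(1 - q)⁻⁴` as a power series. -/
lemma hasSum_cubic {q : ℝ} (h0 : 0 ≤ q) (h1 : q < 1) :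
    HasSum (fun m : ℕ => ((m : ℝ) + 1) * ((m : ℝ) + 2) * ((m : ℝ) + 3) * q ^ m)
      (6 / (1 - q) ^ 4) := by
  have hq : ‖q‖ < 1 := by rwa [Real.norm_of_nonneg h0]
  have h := (summable_choose_mul_geometric_of_norm_lt_one 3 hq).hasSum
  rw [tsum_choose_mul_geometric_of_norm_lt_one 3 hq] at h
  have h2 := h.mul_left 6
  have e1 : (fun m : ℕ => ((m : ℝ) + 1) * ((m : ℝ) + 2) * ((m : ℝ) + 3) * q ^ m) =
      fun m : ℕ => 6 * ((((m + 3).choose 3 : ℕ) : ℝ) * q ^ m) := by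
    funext m
    have h3 : (((m + 3).choose 3 : ℕ) : ℝ) * 6 = ((m : ℝ) + 1) * ((m : ℝ) + 2) * ((m : ℝ) + 3) := by
      have h4 := Nat.descFactorial_eq_factorial_mul_choose (m + 3) 3
      have h5 : (m + 3).descFactorial 3 = (m + 1) * ((m + 2) * (m + 3)) := by
        simp [Nat.descFactorial]
      rw [h5] at h4
      have h6 : ((m : ℝ) + 1) * (((m : ℝ) + 2) * ((m : ℝ) + 3)) =
          (Nat.factorial 3 : ℕ) * (((m + 3).choose 3 : ℕ) : ℝ) := by exact_mod_cast h4
      rw [show Nat.factorial 3 = 6 by rfl] at h6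
      push_cast at h6
      linarith
    rw [← h3]
    ring
  rw [e1, show 6 / (1 - q) ^ 4 = 6 * (1 / (1 - q) ^ (3 + 1)) by ring]
  exact h2

/-- The bounds of the terms of the series for `Tf`, on the ellipse of parameter `ln (R q)`. -/
lemma hasSum_gradCoeff {R q : ℝ} (hR : 1 < R) (h0 : 0 ≤ q) (h1 : q < R) :
    HasSum (fun m : ℕ => gradCoeff R m * ((m : ℝ) + 3) * q ^ m) (6 * R / (R - q) ^ 4) := by
  have hR0 : 0 < R := by linarith
  have h := (hasSum_cubic (q := q / R) (by positivity) ((div_lt_one hR0).mpr h1)).mul_left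
    (R ^ 3)⁻¹
  have e1 : (fun m : ℕ => gradCoeff R m * ((m : ℝ) + 3) * q ^ m) = fun m : ℕ =>
      (R ^ 3)⁻¹ * (((m : ℝ) + 1) * ((m : ℝ) + 2) * ((m : ℝ) + 3) * (q / R) ^ m) := by
    funext m
    unfold gradCoeff
    rw [div_pow, pow_add]
    field_simp
  have e2 : 6 * R / (R - q) ^ 4 = (R ^ 3)⁻¹ * (6 / (1 - q / R) ^ 4) := by
    have : R - q ≠ 0 := by linarith
    have h2 : 1 - q / R = (R - q) / R := by field_simp
    rw [h2]
    field_simp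
  rw [e1, e2]
  exact h

lemma summable_gradCoeff_mul {R : ℝ} (hR : 1 < R) :
    Summable fun m : ℕ => gradCoeff R m * ((m : ℝ) + 3) := by
  simpa using (hasSum_gradCoeff hR zero_le_one hR).summable

lemma summable_gradCoeff {R : ℝ} (hR : 1 < R) : Summable (gradCoeff R) := by
  refine Summable.of_nonneg_of_le (fun m => (gradCoeff_pos hR m).le) (fun m => ?_)
    (summable_gradCoeff_mul hR)
  have h := gradCoeff_pos hR m
  have hm : (0 : ℝ) ≤ m := by positivity
  nlinarith

lemma hasSum_gradiometry {R : ℝ} (hR : 1 < R) (f : L2S2) :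
    HasSum (fun m => gradCoeff R m • Qproj m f) (gradiometry R f) := by
  have h1 : Summable fun m : ℕ => gradCoeff R m • Qproj m := by
    refine Summable.of_norm_bounded (summable_gradCoeff hR) fun m => ?_
    rw [norm_smul, Real.norm_of_nonneg (gradCoeff_pos hR m).le]
    refine mul_le_of_le_one_right (gradCoeff_pos hR m).le ?_
    exact Submodule.starProjection_norm_le _
  exact h1.hasSum.mapL (ContinuousLinearMap.apply ℝ L2S2 f)

lemma Qproj_gradiometry {R : ℝ} (hR : 1 < R) (f : L2S2) (m : ℕ) :
    Qproj m (gradiometry R f) = gradCoeff R m • Qproj m f := by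
  have h := (hasSum_gradiometry hR f).mapL (Qproj m)
  refine h.unique ?_
  have h2 : gradCoeff R m • Qproj m f = Qproj m (gradCoeff R m • Qproj m f) := by
    rw [map_smul, Qproj_of_mem (Qproj_mem m f)]
  rw [h2]
  refine hasSum_single m fun k hk => ?_
  rw [map_smul, Qproj_of_mem_of_ne hk.symm (Qproj_mem k f), smul_zero]

/-- The polynomial representing the component of degree `m`. -/
lemma exists_harmPoly_Qproj (m : ℕ) (f : L2S2) :
    ∃ p ∈ harmPoly m, toL2 (restrictS2 p) = Qproj m f :=
  exists_harmPoly m ⟨_, Qproj_mem m f⟩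

/-- The harmonic polynomial whose restriction is the component of degree `m` of `f`. -/
def component (m : ℕ) (f : L2S2) : MvPolynomial (Fin 3) ℝ := (exists_harmPoly_Qproj m f).choose

lemma component_mem (m : ℕ) (f : L2S2) : component m f ∈ harmPoly m :=
  (exists_harmPoly_Qproj m f).choose_spec.1

lemma toL2_component (m : ℕ) (f : L2S2) : toL2 (restrictS2 (component m f)) = Qproj m f :=
  (exists_harmPoly_Qproj m f).choose_spec.2

/-- Cauchy–Schwarz against the reproducing kernel; its norm bound `√((2m+1)/(4π))` is weakened to
`m+1`. -/
lemma abs_component_le (m : ℕ) (f : L2S2) (x : S2) :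
    |restrictS2 (component m f) x| ≤ ((m : ℝ) + 1) * ‖f‖ := by
  obtain ⟨k, -, h1, -, h2⟩ := exists_reproducingKernel m x
  rw [h1 _ (component_mem m f), toL2_component]
  refine (abs_real_inner_le_norm _ _).trans ?_
  refine mul_le_mul ?_ (norm_Qproj_le m f) (norm_nonneg _) (by positivity)
  refine abs_le_of_sq_le_sq' (h2.trans ?_) (by positivity) |>.2
  rw [div_le_iff₀ (by positivity)]
  have hm : (0 : ℝ) ≤ m := by positivity
  nlinarith [Real.pi_gt_three]

lemma norm_component_le (m : ℕ) (f : L2S2) :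
    ‖restrictS2 (component m f)‖ ≤ ((m : ℝ) + 1) * ‖f‖ :=
  (ContinuousMap.norm_le _ (by positivity)).mpr fun x => abs_component_le m f x

lemma integrable_L2S2 (f : L2S2) : Integrable f surf :=
  (Lp.memLp f).integrable (by norm_num)

/-- The kernel already has degree `m`, so the projection may be dropped from its pairing with `f`,
and the sup bound of the kernel leaves an `L¹` norm. -/
lemma abs_component_le_integral (m : ℕ) (f : L2S2) (x : S2) :
    |restrictS2 (component m f) x| ≤ (2 * m + 1) / (4 * Real.pi) * ∫ y, |f y| ∂surf := by
  obtain ⟨k, h0, h1, h2, -⟩ := exists_reproducingKernel m x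
  rw [h1 _ (component_mem m f), toL2_component, ← inner_Qproj_left, Qproj_of_mem h0,
    L2.inner_def, ← integral_const_mul]
  refine (abs_integral_le_integral_abs).trans ?_
  refine integral_mono_ae (L2.integrable_inner _ _).abs ((integrable_L2S2 f).abs.const_mul _) ?_
  filter_upwards [ContinuousMap.coeFn_toLp (p := 2) (𝕜 := ℝ) surf k] with y hy
  rw [hy]
  simp only [RCLike.inner_apply, conj_trivial, abs_mul]
  rw [mul_comm]
  exact mul_le_mul_of_nonneg_right (h2 y) (abs_nonneg _)

/-- The continuous representative of `Tf`. -/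
def gradRep (R : ℝ) (f : L2S2) : C(S2, ℝ) :=
  ∑' m, gradCoeff R m • restrictS2 (component m f)

/-- Weakening `m+1` to `m+3` completes the product `(m+1)(m+2)(m+3)`, whose power series is
explicit. -/
lemma norm_gradCoeff_component_le {R : ℝ} (hR : 1 < R) (f : L2S2) (m : ℕ) :
    ‖gradCoeff R m • restrictS2 (component m f)‖ ≤ gradCoeff R m * ((m : ℝ) + 3) * ‖f‖ := by
  rw [norm_smul, Real.norm_of_nonneg (gradCoeff_pos hR m).le, mul_assoc]
  refine mul_le_mul_of_nonneg_left ((norm_component_le m f).trans ?_) (gradCoeff_pos hR m).le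
  gcongr
  norm_num

lemma hasSum_gradRep {R : ℝ} (hR : 1 < R) (f : L2S2) :
    HasSum (fun m => gradCoeff R m • restrictS2 (component m f)) (gradRep R f) :=
  (Summable.of_norm_bounded ((summable_gradCoeff_mul hR).mul_right ‖f‖)
    (norm_gradCoeff_component_le hR f)).hasSum

lemma toL2_gradRep {R : ℝ} (hR : 1 < R) (f : L2S2) : toL2 (gradRep R f) = gradiometry R f := by
  have h := (hasSum_gradRep hR f).mapL toL2
  refine h.unique ?_
  convert hasSum_gradiometry hR f using 2 with m
  rw [map_smul, toL2_component]

lemma gradRep_ae_eq {R : ℝ} (hR : 1 < R) (f : L2S2) :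
    gradRep R f =ᵐ[surf] gradiometry R f := by
  rw [← toL2_gradRep hR]
  exact (ContinuousMap.coeFn_toLp (p := 2) (𝕜 := ℝ) surf _).symm

end Operator

end

noncomputable section

/-! ### Circle means of homogeneous polynomials -/

section CircleMean

/-- The monomials `t^j s^k g(θ)` of degree at most `m`, with `g` of the parity of `k` under
`θ ↦ θ + π`. -/
def circMonomials (m : ℕ) : Set (ℝ × ℝ × ℝ → ℝ) :=
  {Φ | ∃ (j k : ℕ) (g : ℝ → ℝ), j + k ≤ m ∧ Continuous g ∧
    (∀ θ, g (θ + Real.pi) = (-1) ^ k * g θ) ∧ Φ = fun q => q.1 ^ j * q.2.1 ^ k * g q.2.2}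

open scoped Pointwise in
lemma circMonomials_mul_subset (m n : ℕ) :
    circMonomials m * circMonomials n ⊆ circMonomials (m + n) := by
  rintro _ ⟨_, ⟨j, k, g, h1, h2, h3, rfl⟩, _, ⟨j', k', g', h1', h2', h3', rfl⟩, rfl⟩
  refine ⟨j + j', k + k', fun θ => g θ * g' θ, by omega, h2.mul h2', fun θ => ?_, ?_⟩
  · simp only [h3, h3']; ring
  · funext q; simp only [Pi.mul_apply]; ring

lemma mul_mem_span_circMonomials {m n : ℕ} {Φ Ψ : ℝ × ℝ × ℝ → ℝ}
    (hΦ : Φ ∈ Submodule.span ℝ (circMonomials m)) (hΨ : Ψ ∈ Submodule.span ℝ (circMonomials n)) :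
    Φ * Ψ ∈ Submodule.span ℝ (circMonomials (m + n)) := by
  have h := Submodule.mul_mem_mul hΦ hΨ
  rw [Submodule.span_mul_span] at h
  exact Submodule.span_mono (circMonomials_mul_subset m n) h

lemma pow_mem_span_circMonomials {Φ : ℝ × ℝ × ℝ → ℝ}
    (hΦ : Φ ∈ Submodule.span ℝ (circMonomials 1)) (n : ℕ) :
    Φ ^ n ∈ Submodule.span ℝ (circMonomials n) := by
  induction n with
  | zero =>
    refine Submodule.subset_span ⟨0, 0, fun _ => 1, le_rfl, continuous_const, by simp, ?_⟩
    funext q; simp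
  | succ n ih =>
    rw [pow_succ]
    exact mul_mem_span_circMonomials ih hΦ

/-- Each coordinate is `t` times a constant plus `s` times a function changing sign under `θ ↦ θ +
π`, hence of degree one; a homogeneous polynomial combines products of exactly `m` of these. -/
lemma eval_mem_span_circMonomials {m : ℕ} {p : MvPolynomial (Fin 3) ℝ} (hp : p.IsHomogeneous m)
    (x a b : Fin 3 → ℝ) :
    (fun q : ℝ × ℝ × ℝ => MvPolynomial.eval (fun i => q.1 * x i +
      q.2.1 * (Real.cos q.2.2 * a i + Real.sin q.2.2 * b i)) p) ∈
      Submodule.span ℝ (circMonomials m) := by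
  have hlin : ∀ i, (fun q : ℝ × ℝ × ℝ => q.1 * x i +
      q.2.1 * (Real.cos q.2.2 * a i + Real.sin q.2.2 * b i)) ∈
      Submodule.span ℝ (circMonomials 1) := by
    intro i
    have h1 : (fun q : ℝ × ℝ × ℝ => q.1 ^ 1 * q.2.1 ^ 0 * x i) ∈
        Submodule.span ℝ (circMonomials 1) :=
      Submodule.subset_span ⟨1, 0, fun _ => x i, le_rfl, continuous_const, by simp, rfl⟩
    have h2 : (fun q : ℝ × ℝ × ℝ => q.1 ^ 0 * q.2.1 ^ 1 *
        (Real.cos q.2.2 * a i + Real.sin q.2.2 * b i)) ∈ Submodule.span ℝ (circMonomials 1) :=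
      Submodule.subset_span ⟨0, 1, fun θ => Real.cos θ * a i + Real.sin θ * b i, le_rfl,
        by fun_prop, fun θ => by simp; ring, rfl⟩
    have h3 := Submodule.add_mem _ h1 h2
    convert h3 using 1
    funext q
    simp
  have hfun : (fun q : ℝ × ℝ × ℝ => MvPolynomial.eval (fun i => q.1 * x i +
      q.2.1 * (Real.cos q.2.2 * a i + Real.sin q.2.2 * b i)) p) =
      ∑ d ∈ p.support, p.coeff d • ∏ i, (fun q : ℝ × ℝ × ℝ => q.1 * x i +
        q.2.1 * (Real.cos q.2.2 * a i + Real.sin q.2.2 * b i)) ^ d i := by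
    funext q
    rw [MvPolynomial.eval_eq']
    simp [Finset.sum_apply, Finset.prod_apply]
  rw [hfun]
  refine Submodule.sum_mem _ fun d hd => Submodule.smul_mem _ _ ?_
  have h : ∑ i, d i = m := by
    rw [← Finsupp.degree_eq_sum, Finsupp.degree_eq_weight_one]
    exact hp (MvPolynomial.mem_support_iff.mp hd)
  rw [Fin.sum_univ_three] at h
  rw [Fin.prod_univ_three, ← h]
  exact mul_mem_span_circMonomials (mul_mem_span_circMonomials
    (pow_mem_span_circMonomials (hlin 0) _) (pow_mem_span_circMonomials (hlin 1) _))
    (pow_mem_span_circMonomials (hlin 2) _)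

lemma integral_eq_zero_of_antiperiodic {g : ℝ → ℝ} (hg : Continuous g)
    (h : ∀ θ, g (θ + Real.pi) = -g θ) : ∫ θ in (0 : ℝ)..(2 * Real.pi), g θ = 0 := by
  rw [← intervalIntegral.integral_add_adjacent_intervals (b := Real.pi)
    (hg.intervalIntegrable _ _) (hg.intervalIntegrable _ _)]
  have h1 := intervalIntegral.integral_comp_add_right (a := 0) (b := Real.pi) g Real.pi
  rw [zero_add, ← two_mul] at h1
  rw [← h1]
  simp [h]

/-- Here `s = √(1-t²)`: even powers are polynomials in `t`, and odd powers carry an antiperiodic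
factor with zero integral. Continuity in `θ` is carried through the induction because integrating
sums needs integrability. -/
lemma integral_mem_span_circMonomials {m : ℕ} {Φ : ℝ × ℝ × ℝ → ℝ}
    (hΦ : Φ ∈ Submodule.span ℝ (circMonomials m)) :
    (∀ t s, Continuous fun θ => Φ (t, s, θ)) ∧ ∃ P : Polynomial ℝ, P.natDegree ≤ m ∧
      ∀ t ∈ Set.Icc (-1 : ℝ) 1,
        ∫ θ in (0 : ℝ)..(2 * Real.pi), Φ (t, √(1 - t ^ 2), θ) = P.eval t := by
  induction hΦ using Submodule.span_induction with
  | mem Φ h =>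
    obtain ⟨j, k, g, hjk, hg, hpar, rfl⟩ := h
    refine ⟨fun t s => by dsimp only; fun_prop, ?_⟩
    rcases Nat.even_or_odd k with ⟨l, rfl⟩ | hk
    · refine ⟨Polynomial.C (∫ θ in (0 : ℝ)..(2 * Real.pi), g θ) *
        (Polynomial.X ^ j * (1 - Polynomial.X ^ 2) ^ l), ?_, ?_⟩
      · refine (Polynomial.natDegree_C_mul_le _ _).trans ?_
        have h1 : (1 - Polynomial.X ^ 2 : Polynomial ℝ).natDegree ≤ 2 := by
          compute_degree
        refine (Polynomial.natDegree_mul_le_of_le (Polynomial.natDegree_X_pow_le j)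
          (Polynomial.natDegree_pow_le_of_le l h1)).trans (by omega)
      · intro t ht
        have h2 : √(1 - t ^ 2) ^ (l + l) = (1 - t ^ 2) ^ l := by
          rw [← two_mul, pow_mul, Real.sq_sqrt (by nlinarith [ht.1, ht.2])]
        simp only [intervalIntegral.integral_const_mul, h2, Polynomial.eval_mul,
          Polynomial.eval_C, Polynomial.eval_pow, Polynomial.eval_X, Polynomial.eval_sub,
          Polynomial.eval_one]
        ring
    · refine ⟨0, by simp, fun t _ => ?_⟩
      simp only [intervalIntegral.integral_const_mul, Polynomial.eval_zero]
      rw [integral_eq_zero_of_antiperiodic hg (fun θ => by rw [hpar, hk.neg_one_pow]; ring),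
        mul_zero]
  | zero => exact ⟨fun _ _ => continuous_const, 0, by simp, by simp⟩
  | add Φ Ψ _ _ h1 h2 =>
    obtain ⟨c1, P, hP, h1⟩ := h1
    obtain ⟨c2, Q, hQ, h2⟩ := h2
    refine ⟨fun t s => (c1 t s).add (c2 t s), P + Q, Polynomial.natDegree_add_le_of_degree_le hP hQ,
      fun t ht => ?_⟩
    simp only [Pi.add_apply, Polynomial.eval_add]
    rw [intervalIntegral.integral_add ((c1 _ _).intervalIntegrable _ _)
      ((c2 _ _).intervalIntegrable _ _), h1 t ht, h2 t ht]
  | smul c Φ _ h1 =>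
    obtain ⟨c1, P, hP, h1⟩ := h1
    refine ⟨fun t s => (c1 t s).const_smul c, Polynomial.C c * P,
      (Polynomial.natDegree_C_mul_le _ _).trans hP, fun t ht => ?_⟩
    simp only [Pi.smul_apply, smul_eq_mul, intervalIntegral.integral_const_mul, h1 t ht,
      Polynomial.eval_mul, Polynomial.eval_C]

/-- The circle means of a homogeneous polynomial are polynomials in the height of the circle. -/
lemma exists_polynomial_circleMean {m : ℕ} {p : MvPolynomial (Fin 3) ℝ} (hp : p.IsHomogeneous m)
    (x : S2) : ∃ P : Polynomial ℝ, P.natDegree ≤ m ∧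
      ∀ t : Set.Icc (-1 : ℝ) 1, circleMean (restrictS2 p) x t = P.eval (t : ℝ) := by
  obtain ⟨-, P, hP, h⟩ := integral_mem_span_circMonomials
    (eval_mem_span_circMonomials hp (fun i => (x : E3) i) (fun i => (frame x).1 i)
      (fun i => (frame x).2 i))
  refine ⟨Polynomial.C (2 * Real.pi)⁻¹ * P, (Polynomial.natDegree_C_mul_le _ _).trans hP,
    fun t => ?_⟩
  rw [Polynomial.eval_mul, Polynomial.eval_C, ← h t t.2]
  simp [circleMean, restrictS2_apply, circlePoint, mul_add]

lemma continuous_circlePoint (x : S2) (t : Set.Icc (-1 : ℝ) 1) : Continuous (circlePoint x t) := by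
  unfold circlePoint
  refine Continuous.subtype_mk ?_ _
  fun_prop

lemma abs_circleMean_le (g : C(S2, ℝ)) (x : S2) (t : Set.Icc (-1 : ℝ) 1) :
    |circleMean g x t| ≤ ‖g‖ := by
  have h := intervalIntegral.norm_integral_le_of_norm_le_const (a := 0) (b := 2 * Real.pi)
    (f := fun θ => g (circlePoint x t θ)) (C := ‖g‖) fun θ _ => g.norm_coe_le_norm _
  have hpi : (0 : ℝ) ≤ 2 * Real.pi := by positivity
  rw [Real.norm_eq_abs, sub_zero, abs_of_nonneg hpi] at h
  rw [circleMean, abs_mul, abs_of_nonneg (inv_nonneg.mpr hpi), inv_mul_le_iff₀ (by positivity)]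
  linarith

/-- The circle mean as a functional. -/
def circleMeanCLM (x : S2) (t : Set.Icc (-1 : ℝ) 1) : C(S2, ℝ) →L[ℝ] ℝ :=
  LinearMap.mkContinuous
    { toFun := fun g => circleMean g x t
      map_add' := fun f g => by
        have hf := (f.continuous.comp (continuous_circlePoint x t)).intervalIntegrable
          (μ := volume) 0 (2 * Real.pi)
        have hg := (g.continuous.comp (continuous_circlePoint x t)).intervalIntegrable
          (μ := volume) 0 (2 * Real.pi)
        simp only [circleMean, ContinuousMap.add_apply]
        rw [← mul_add]
        exact congrArg _ (intervalIntegral.integral_add hf hg)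
      map_smul' := fun c f => by
        simp [circleMean]
        ring } 1
    fun g => by simpa using abs_circleMean_le g x t

lemma circleMeanCLM_apply (x : S2) (t : Set.Icc (-1 : ℝ) 1) (g : C(S2, ℝ)) :
    circleMeanCLM x t g = circleMean g x t := rfl

end CircleMean

/-! ### Growth of polynomials on ellipses -/

section Bernstein

/-- The cosine maps the line `Im α = ρ` to the ellipse with semi-axes `cosh ρ` and `sinh ρ`, so `ρ >
r` would put the image outside. Evenness of the cosine allows `Im α ≥ 0`. -/
lemma exists_cos_of_mem_ellipse {r : ℝ≥0} (hr : 0 < r) {z : ℂ} (hz : z ∈ ellipse r) :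
    ∃ α : ℂ, Complex.cos α = z ∧ 0 ≤ α.im ∧ α.im ≤ r := by
  obtain ⟨α, hα, h0⟩ : ∃ α : ℂ, Complex.cos α = z ∧ 0 ≤ α.im := by
    obtain ⟨α, hα⟩ := Complex.cos_surjective z
    rcases le_total 0 α.im with h | h
    · exact ⟨α, hα, h⟩
    · exact ⟨-α, by rw [Complex.cos_neg, hα], by simpa using h⟩
  refine ⟨α, hα, h0, ?_⟩
  by_contra! hlt
  have hr' : (0 : ℝ) < r := hr
  have hre : z.re = Real.cos α.re * Real.cosh α.im := by
    rw [← hα, Complex.cos_eq]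
    simp [← Complex.ofReal_cos, ← Complex.ofReal_cosh, ← Complex.ofReal_sin, ← Complex.ofReal_sinh]
  have him : z.im = -(Real.sin α.re * Real.sinh α.im) := by
    rw [← hα, Complex.cos_eq]
    simp [← Complex.ofReal_cos, ← Complex.ofReal_cosh, ← Complex.ofReal_sin, ← Complex.ofReal_sinh]
  have hz' : z.re ^ 2 / Real.cosh r ^ 2 + z.im ^ 2 / Real.sinh r ^ 2 ≤ 1 := hz
  have hc0 : 0 < Real.cosh r := Real.cosh_pos _
  have hs0 : 0 < Real.sinh r := Real.sinh_pos_iff.mpr hr'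
  have hc : Real.cosh r < Real.cosh α.im := by
    rw [Real.cosh_lt_cosh, abs_of_pos hr', abs_of_nonneg h0]; exact hlt
  have hs : Real.sinh r < Real.sinh α.im := Real.sinh_lt_sinh.mpr hlt
  have hA : 1 < Real.cosh α.im ^ 2 / Real.cosh r ^ 2 := by
    rw [one_lt_div (by positivity)]
    exact pow_lt_pow_left₀ hc hc0.le two_ne_zero
  have hB : 1 < Real.sinh α.im ^ 2 / Real.sinh r ^ 2 := by
    rw [one_lt_div (by positivity)]
    exact pow_lt_pow_left₀ hs hs0.le two_ne_zero
  rw [hre, him, neg_sq, mul_pow, mul_pow, mul_div_assoc, mul_div_assoc] at hz'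
  have h1 := Real.sin_sq_add_cos_sq α.re
  set A := Real.cosh α.im ^ 2 / Real.cosh r ^ 2
  set B := Real.sinh α.im ^ 2 / Real.sinh r ^ 2
  rcases eq_or_lt_of_le (sq_nonneg (Real.cos α.re)) with h2 | h2
  · nlinarith [sq_nonneg (Real.sin α.re)]
  · nlinarith [sq_nonneg (Real.sin α.re)]

/-- Bernstein's inequality: the growth of a polynomial on the ellipses with foci `± 1`. -/
lemma norm_aeval_le_of_mem_ellipse {P : Polynomial ℝ} {m : ℕ} (hP : P.natDegree ≤ m) {M : ℝ}
    (hM : ∀ t ∈ Set.Icc (-1 : ℝ) 1, |P.eval t| ≤ M) {r : ℝ≥0} (hr : 0 < r) {z : ℂ}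
    (hz : z ∈ ellipse r) : ‖Polynomial.aeval z P‖ ≤ M * Real.exp r ^ m := by
  obtain ⟨α, rfl, h0, h1⟩ := exists_cos_of_mem_ellipse hr hz
  -- This is `w^m P((w + w⁻¹)/2)` with its denominators cleared, an entire function. On the unit
  -- circle the argument of `P` is `Re w ∈ [-1,1]`, so the maximum principle bounds `q` by `M` on
  -- the disc; evaluate at `w = e^{iα}`, where `|w| = e^{-Im α}`.
  set q : ℂ → ℂ := fun w => ∑ k ∈ Finset.range (m + 1),
    P.coeff k • (((w ^ 2 + 1) / 2) ^ k * w ^ (m - k)) with hq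
  have hqd : Differentiable ℂ q := by
    simp only [hq]
    fun_prop
  have hqw : ∀ w : ℂ, w ≠ 0 → q w = w ^ m * Polynomial.aeval ((w + w⁻¹) / 2) P := by
    intro w hw
    rw [Polynomial.aeval_eq_sum_range' (Nat.lt_succ_of_le hP), Finset.mul_sum]
    refine Finset.sum_congr rfl fun k hk => ?_
    have hk' : k ≤ m := Nat.lt_succ_iff.mp (Finset.mem_range.mp hk)
    rw [mul_smul_comm]
    congr 1
    have h3 : (w ^ 2 + 1) / 2 = w * ((w + w⁻¹) / 2) := by field_simp
    rw [h3, mul_pow, mul_right_comm, ← pow_add, Nat.add_sub_cancel' hk']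
  have hcirc : ∀ w ∈ frontier (Metric.ball (0 : ℂ) 1), ‖q w‖ ≤ M := by
    intro w hw
    rw [frontier_ball _ one_ne_zero, mem_sphere_zero_iff_norm] at hw
    have hw0 : w ≠ 0 := by
      rintro rfl; simp at hw
    have h4 : (w + w⁻¹) / 2 = ((w.re : ℝ) : ℂ) := by
      rw [Complex.inv_eq_conj hw, Complex.add_conj]
      push_cast
      ring
    rw [hqw w hw0, norm_mul, norm_pow, hw, one_pow, one_mul, h4]
    have h5 : Polynomial.aeval ((w.re : ℝ) : ℂ) P = ((P.eval w.re : ℝ) : ℂ) := by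
      rw [← Complex.coe_algebraMap, Polynomial.aeval_algebraMap_apply, Polynomial.coe_aeval_eq_eval]
    rw [h5, Complex.norm_real]
    refine hM _ ⟨?_, ?_⟩
    · have := (abs_le.mp (Complex.abs_re_le_norm w)).1; linarith
    · have := (abs_le.mp (Complex.abs_re_le_norm w)).2; linarith
  have hexp : ‖Complex.exp (α * Complex.I)‖ = Real.exp (-α.im) := by
    rw [Complex.norm_exp]; simp
  have hball : ‖q (Complex.exp (α * Complex.I))‖ ≤ M := by
    refine Complex.norm_le_of_forall_mem_frontier_norm_le Metric.isBounded_ball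
      hqd.diffContOnCl hcirc ?_
    rw [closure_ball _ one_ne_zero, mem_closedBall_zero_iff, hexp, Real.exp_le_one_iff]
    linarith
  rw [hqw _ (Complex.exp_ne_zero _), ← Complex.exp_neg, ← neg_mul,
    show (Complex.exp (α * Complex.I) + Complex.exp (-α * Complex.I)) / 2 = Complex.cos α from rfl,
    norm_mul, norm_pow, hexp] at hball
  have hpos : 0 < Real.exp (-α.im) ^ m := by positivity
  have hM0 : 0 ≤ M := (abs_nonneg _).trans (hM 0 (by norm_num))
  calc ‖Polynomial.aeval (Complex.cos α) P‖
      = Real.exp α.im ^ m * (Real.exp (-α.im) ^ m * ‖Polynomial.aeval (Complex.cos α) P‖) := by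
        rw [← mul_assoc, ← mul_pow, ← Real.exp_add, add_neg_cancel, Real.exp_zero, one_pow, one_mul]
    _ ≤ Real.exp r ^ m * M := by gcongr
    _ = M * Real.exp r ^ m := mul_comm _ _

end Bernstein

end

noncomputable section

/-! ### Holomorphic extension and the bound in the analytic space -/

section AnalyticBound

lemma lt_log_of_lt_weightRadius {R : ℝ} {r : ℝ≥0}
    (h : (r : ℝ≥0∞) < weightRadius (gradWeight R)) : (r : ℝ) < Real.log R := by
  obtain ⟨r', h⟩ := lt_iSup_iff.mp h
  obtain ⟨h', h⟩ := lt_iSup_iff.mp h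
  have h1 : (r : ℝ) < r' := by exact_mod_cast h
  refine h1.trans ?_
  by_contra h2
  simp [gradWeight, h2] at h'

lemma exp_neg_gradWeight {R : ℝ} (hR : 1 < R) {r : ℝ≥0} (h : (r : ℝ) < Real.log R) :
    EReal.exp (-gradWeight R r) = ENNReal.ofReal ((R - Real.exp r) ^ 4) := by
  have hpos : 0 < R - Real.exp r := by
    rw [sub_pos]
    exact (Real.lt_log_iff_exp_lt (by linarith)).mp h
  rw [gradWeight, if_pos h, ← EReal.coe_neg, EReal.exp_coe]
  congr 1
  rw [neg_mul, neg_neg, show 4 * Real.log (R - Real.exp r) = ((4 : ℕ) : ℝ) *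
    Real.log (R - Real.exp r) by norm_num, Real.exp_nat_mul, Real.exp_log hpos]

/-- The interior of the ellipse of parameter `r`. -/
def openEllipse (r : ℝ≥0) : Set ℂ :=
  {z | z.re ^ 2 / Real.cosh r ^ 2 + z.im ^ 2 / Real.sinh r ^ 2 < 1}

lemma isOpen_openEllipse (r : ℝ≥0) : IsOpen (openEllipse r) :=
  isOpen_lt (by fun_prop) continuous_const

lemma ellipse_subset_openEllipse {r r' : ℝ≥0} (hr : 0 < r) (h : r < r') :
    ellipse r ⊆ openEllipse r' := by
  intro z hz
  have hr0 : (0 : ℝ) < r := hr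
  have hrr : (r : ℝ) < r' := h
  have hc0 : 0 < Real.cosh r := Real.cosh_pos _
  have hs0 : 0 < Real.sinh r := Real.sinh_pos_iff.mpr hr0
  have hc : Real.cosh r ^ 2 < Real.cosh r' ^ 2 := by
    refine pow_lt_pow_left₀ ?_ hc0.le two_ne_zero
    rw [Real.cosh_lt_cosh, abs_of_pos hr0, abs_of_pos (hr0.trans hrr)]
    exact hrr
  have hs : Real.sinh r ^ 2 < Real.sinh r' ^ 2 :=
    pow_lt_pow_left₀ (Real.sinh_lt_sinh.mpr hrr) hs0.le two_ne_zero
  change z.re ^ 2 / Real.cosh r ^ 2 + z.im ^ 2 / Real.sinh r ^ 2 ≤ 1 at hz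
  change z.re ^ 2 / Real.cosh r' ^ 2 + z.im ^ 2 / Real.sinh r' ^ 2 < 1
  have h1 : z.re ^ 2 / Real.cosh r' ^ 2 ≤ z.re ^ 2 / Real.cosh r ^ 2 := by gcongr
  have h2 : z.im ^ 2 / Real.sinh r' ^ 2 ≤ z.im ^ 2 / Real.sinh r ^ 2 := by gcongr
  rcases eq_or_ne z.re 0 with hx | hx
  · rcases eq_or_ne z.im 0 with hy | hy
    · simp [hx, hy]
    · have : z.im ^ 2 / Real.sinh r' ^ 2 < z.im ^ 2 / Real.sinh r ^ 2 :=
        div_lt_div_of_pos_left (by positivity) (by positivity) hs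
      linarith
  · have : z.re ^ 2 / Real.cosh r' ^ 2 < z.re ^ 2 / Real.cosh r ^ 2 :=
      div_lt_div_of_pos_left (by positivity) (by positivity) hc
    linarith

/-- The circle means of a component of `f`, as a polynomial. -/
lemma exists_componentPoly (m : ℕ) (f : L2S2) (x : S2) : ∃ P : Polynomial ℝ, P.natDegree ≤ m ∧
    ∀ t : Set.Icc (-1 : ℝ) 1, circleMean (restrictS2 (component m f)) x t = P.eval (t : ℝ) :=
  exists_polynomial_circleMean ((MvPolynomial.mem_homogeneousSubmodule _ _).mp
    (Submodule.mem_inf.mp (component_mem m f)).1) x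

/-- The circle means of a component of `f`, as a polynomial. -/
def componentPoly (m : ℕ) (f : L2S2) (x : S2) : Polynomial ℝ := (exists_componentPoly m f x).choose

lemma norm_componentPoly_le (m : ℕ) (f : L2S2) (x : S2) {r : ℝ≥0} (hr : 0 < r) {z : ℂ}
    (hz : z ∈ ellipse r) :
    ‖Polynomial.aeval z (componentPoly m f x)‖ ≤ ((m : ℝ) + 1) * ‖f‖ * Real.exp r ^ m := by
  obtain ⟨h1, h2⟩ := (exists_componentPoly m f x).choose_spec
  refine norm_aeval_le_of_mem_ellipse h1 (fun t ht => ?_) hr hz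
  rw [← h2 ⟨t, ht⟩]
  exact (abs_circleMean_le _ _ _).trans (norm_component_le m f)

/-- The holomorphic extension of the circle means of `Tf`. -/
def gradExtension (R : ℝ) (f : L2S2) (x : S2) (z : ℂ) : ℂ :=
  ∑' m, (gradCoeff R m : ℂ) * Polynomial.aeval z (componentPoly m f x)

lemma norm_gradExtension_term_le {R : ℝ} (hR : 1 < R) (f : L2S2) (x : S2) (m : ℕ) {r : ℝ≥0}
    (hr : 0 < r) {z : ℂ} (hz : z ∈ ellipse r) :
    ‖(gradCoeff R m : ℂ) * Polynomial.aeval z (componentPoly m f x)‖ ≤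
      gradCoeff R m * ((m : ℝ) + 3) * Real.exp r ^ m * ‖f‖ := by
  have h0 := gradCoeff_pos hR m
  rw [norm_mul, Complex.norm_real, Real.norm_of_nonneg h0.le]
  calc gradCoeff R m * ‖Polynomial.aeval z (componentPoly m f x)‖
      ≤ gradCoeff R m * (((m : ℝ) + 3) * ‖f‖ * Real.exp r ^ m) := by
        refine mul_le_mul_of_nonneg_left ((norm_componentPoly_le m f x hr hz).trans ?_) h0.le
        gcongr
        norm_num
    _ = _ := by ring

lemma exp_lt_of_lt_log {R : ℝ} (hR : 1 < R) {r : ℝ} (h : r < Real.log R) : Real.exp r < R :=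
  (Real.lt_log_iff_exp_lt (by linarith)).mp h

lemma norm_gradExtension_le {R : ℝ} (hR : 1 < R) (f : L2S2) (x : S2) {r : ℝ≥0}
    (hr : 0 < r) (hrR : (r : ℝ) < Real.log R) {z : ℂ} (hz : z ∈ ellipse r) :
    ‖gradExtension R f x z‖ ≤ 6 * R / (R - Real.exp r) ^ 4 * ‖f‖ := by
  have h := (hasSum_gradCoeff hR (Real.exp_pos r).le (exp_lt_of_lt_log hR hrR)).mul_right ‖f‖
  exact tsum_of_norm_bounded h fun m => norm_gradExtension_term_le hR f x m hr hz

/-- Around a point of the ellipse `r`, the series converges uniformly on a larger open ellipse `r' <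
log R`, so its sum is holomorphic. On real points it is the circle mean, a continuous functional
applied termwise. -/
lemma isEllipseExtension_gradExtension {R : ℝ} (hR : 1 < R) (f : L2S2) (x : S2) :
    IsEllipseExtension (gradWeight R) (circleMean (gradRep R f) x) (gradExtension R f x) := by
  constructor
  · intro z hz
    simp only [ellipseDomain, Set.mem_iUnion] at hz
    obtain ⟨r, hr, hrw, hz⟩ := hz
    have hrR := lt_log_of_lt_weightRadius hrw
    obtain ⟨s, hs1, hs2⟩ := exists_between hrR
    have hs0 : 0 < s := (show (0 : ℝ) < r from hr).trans hs1
    obtain ⟨r', rfl⟩ : ∃ r' : ℝ≥0, (r' : ℝ) = s := ⟨⟨s, hs0.le⟩, rfl⟩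
    have hr'0 : 0 < r' := hs0
    have hd : DifferentiableOn ℂ (gradExtension R f x) (openEllipse r') := by
      refine Complex.differentiableOn_tsum_of_summable_norm
        ((hasSum_gradCoeff hR (Real.exp_pos r').le (exp_lt_of_lt_log hR hs2)).mul_right ‖f‖).summable
        (fun m => ?_) (isOpen_openEllipse r') fun m w hw =>
          norm_gradExtension_term_le hR f x m hr'0 (Set.mem_ofPred.mpr (le_of_lt hw))
      exact ((Polynomial.differentiable_aeval _).const_mul _).differentiableOn
    exact (hd.differentiableAt ((isOpen_openEllipse r').mem_nhds
      (ellipse_subset_openEllipse hr hs1 hz))).differentiableWithinAt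
  · intro t _
    have h := ((hasSum_gradRep hR f).mapL (circleMeanCLM x t)).mapL Complex.ofRealCLM
    have h2 := h.tsum_eq
    rw [Complex.ofRealCLM_apply, circleMeanCLM_apply] at h2
    rw [← h2, gradExtension]
    congr 1
    funext m
    rw [map_smul, circleMeanCLM_apply, Complex.ofRealCLM_apply, smul_eq_mul, Complex.ofReal_mul,
      (exists_componentPoly m f x).choose_spec.2 t]
    congr 1
    rw [← Complex.coe_algebraMap, Polynomial.aeval_algebraMap_apply, Polynomial.coe_aeval_eq_eval]
    rfl

/-- The factor `e^{-λ(r)} = (R-e^r)^4` cancels the denominator in `norm_gradExtension_le` exactly.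
-/
lemma intervalNorm_gradRep_le {R : ℝ} (hR : 1 < R) (f : L2S2) (x : S2) :
    intervalNorm (gradWeight R) (circleMean (gradRep R f) x) ≤ ENNReal.ofReal (6 * R * ‖f‖) := by
  refine (iInf₂_le _ (isEllipseExtension_gradExtension hR f x)).trans ?_
  refine iSup_le fun r => iSup₂_le fun hr hrw => ?_
  have hrR := lt_log_of_lt_weightRadius hrw
  have hpos : 0 < R - Real.exp r := sub_pos.mpr (exp_lt_of_lt_log hR hrR)
  have h1 : ⨆ (z : ℂ) (_ : z ∈ ellipseCurve r), ‖gradExtension R f x z‖ₑ ≤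
      ENNReal.ofReal (6 * R / (R - Real.exp r) ^ 4 * ‖f‖) := by
    refine iSup₂_le fun z hz => ?_
    rw [← ofReal_norm]
    exact ENNReal.ofReal_le_ofReal
      (norm_gradExtension_le hR f x hr hrR (Set.mem_ofPred.mpr (le_of_eq hz)))
  rw [exp_neg_gradWeight hR hrR]
  refine (mul_le_mul_right h1 _).trans ?_
  rw [← ENNReal.ofReal_mul (by positivity)]
  refine ENNReal.ofReal_le_ofReal (le_of_eq ?_)
  field_simp

lemma sphereNorm_gradRep_le {R : ℝ} (hR : 1 < R) (f : L2S2) :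
    sphereNorm (gradWeight R) (gradRep R f) ≤ ENNReal.ofReal (6 * R * ‖f‖) :=
  iSup_le fun x => intervalNorm_gradRep_le hR f x

lemma memSphereA_gradRep {R : ℝ} (hR : 1 < R) (f : L2S2) :
    MemSphereA (gradWeight R) (gradRep R f) :=
  ⟨fun x => ⟨⟨_, isEllipseExtension_gradExtension hR f x⟩,
    (intervalNorm_gradRep_le hR f x).trans_lt ENNReal.ofReal_lt_top⟩,
    (sphereNorm_gradRep_le hR f).trans_lt ENNReal.ofReal_lt_top⟩

end AnalyticBound

end

noncomputable section

/-! ### The Bregman distance of the squared norm -/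

section Bregman

variable {H : Type*} [NormedAddCommGroup H] [InnerProductSpace ℝ H]

lemma subgradient_norm_sq {u : H} {ξ : StrongDual ℝ H}
    (hξ : IsSubgradient (fun f : H => ‖f‖ ^ 2) u ξ) (h : H) : ξ h = 2 * inner ℝ u h := by
  set d := ξ h - 2 * inner ℝ u h with hd
  set N := ‖h‖ ^ 2 with hN
  have hN0 : 0 ≤ N := sq_nonneg _
  -- Testing the subgradient inequality at `u + t h` leaves a linear term dominated by a quadratic
  -- one for every `t`, which forces `d = 0`; the test value `d/(N+1)` also covers `N = 0`.
  have key : ∀ t : ℝ, t * d ≤ t ^ 2 * N := by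
    intro t
    have h1 := hξ (u + t • h)
    simp only [add_sub_cancel_left, map_smul, smul_eq_mul] at h1
    rw [norm_add_sq_real, inner_smul_right, norm_smul, mul_pow, Real.norm_eq_abs, sq_abs] at h1
    rw [hd]
    linarith
  have h2 := key (d / (N + 1))
  have h3 : d ^ 2 * (N + 1) ≤ d ^ 2 * N := by
    have h4 : d / (N + 1) * d * (N + 1) ^ 2 ≤ (d / (N + 1)) ^ 2 * N * (N + 1) ^ 2 :=
      mul_le_mul_of_nonneg_right h2 (by positivity)
    have hne : N + 1 ≠ 0 := by positivity
    field_simp at h4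
    linarith
  have h5 : d = 0 := by nlinarith
  linarith

lemma bregman_norm_sq {u : H} {ξ : StrongDual ℝ H}
    (hξ : IsSubgradient (fun f : H => ‖f‖ ^ 2) u ξ) (f : H) :
    bregman (fun f : H => ‖f‖ ^ 2) u ξ f = ‖f - u‖ ^ 2 := by
  simp only [bregman, subgradient_norm_sq hξ]
  rw [inner_sub_right, norm_sub_sq_real, real_inner_self_eq_norm_sq, real_inner_comm]
  ring

lemma convexOn_norm_sq : ConvexOn ℝ Set.univ (fun f : H => ‖f‖ ^ 2) :=
  (convexOn_norm convex_univ).pow (fun _ _ => norm_nonneg _) 2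

end Bregman

/-! ### Monotonicity and limit of the function `γ` -/

section RealAnalysis

/-- From `log (y/x) < y/x - 1` and `a/x ≤ 1`. It serves both `γ`, with `a = 5`, and the concavity of
`logIndex`, with `a = s+1`. -/
lemma strictAntiOn_rpow_mul_exp_neg {a : ℝ} (ha : 0 < a) :
    StrictAntiOn (fun x : ℝ => x ^ a * Real.exp (-x)) (Set.Ici a) := by
  intro x hx y _ hxy
  have hx0 : 0 < x := ha.trans_le hx
  have hy0 : 0 < y := hx0.trans hxy
  have h1 : Real.log (y / x) < y / x - 1 :=
    Real.log_lt_sub_one_of_pos (by positivity) (by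
      rw [Ne, div_eq_one_iff_eq hx0.ne']; exact hxy.ne')
  rw [Real.log_div hy0.ne' hx0.ne'] at h1
  have h2 : a * (y / x - 1) ≤ y - x := by
    have h3 : a / x ≤ 1 := (div_le_one hx0).mpr hx
    have h4 : a * (y / x - 1) = a / x * (y - x) := by field_simp
    rw [h4]
    nlinarith
  simp only [Real.rpow_def_of_pos hx0, Real.rpow_def_of_pos hy0, ← Real.exp_add]
  apply Real.exp_lt_exp.mpr
  nlinarith [mul_lt_mul_of_pos_left h1 ha]

/-- The function `γ` of the smoothing property. -/
def gammaFun (R δ : ℝ) : ℝ :=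
  (4 * Real.pi) ^ (5 / 2 : ℝ) * δ ^ (-(5 / 2) : ℝ) * R ^ (-√(4 * Real.pi / δ) - 4)

lemma gammaFun_zero (R : ℝ) : gammaFun R 0 = 0 := by
  -- The convention that `0` to a nonzero real power is `0` makes the formula itself give `γ(0) =
  -- 0`.
  rw [gammaFun, Real.zero_rpow (by norm_num)]
  ring

/-- The constant `(4π)^{5/2}` is chosen so that, with `v = √(4π/δ)`, the powers of `δ` and `π`
combine to `v⁵`. -/
lemma gammaFun_eq {R δ : ℝ} (hR : 1 < R) (hδ : 0 < δ) :
    gammaFun R δ = √(4 * Real.pi / δ) ^ (5 : ℝ) *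
      Real.exp (-(Real.log R * √(4 * Real.pi / δ))) / R ^ 4 := by
  have h1 : (4 * Real.pi) ^ (5 / 2 : ℝ) * δ ^ (-(5 / 2) : ℝ) =
      √(4 * Real.pi / δ) ^ (5 : ℝ) := by
    rw [Real.rpow_neg hδ.le, ← div_eq_mul_inv, ← Real.div_rpow (by positivity) hδ.le,
      Real.sqrt_eq_rpow, ← Real.rpow_mul (by positivity)]
    norm_num
  have h2 : R ^ (-√(4 * Real.pi / δ) - 4) =
      Real.exp (-(Real.log R * √(4 * Real.pi / δ))) / R ^ 4 := by
    have hR0 : 0 < R := by linarith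
    rw [Real.rpow_sub hR0, Real.rpow_def_of_pos hR0]
    norm_cast
    rw [mul_neg]
  rw [gammaFun, h1, h2]
  ring

lemma gammaFun_pos {R δ : ℝ} (hR : 1 < R) (hδ : 0 < δ) : 0 < gammaFun R δ := by
  unfold gammaFun
  have := Real.pi_pos
  positivity

lemma gammaFun_eq' {R δ : ℝ} (hR : 1 < R) (hδ : 0 < δ) :
    gammaFun R δ = (Real.log R * √(4 * Real.pi / δ)) ^ (5 : ℝ) *
      Real.exp (-(Real.log R * √(4 * Real.pi / δ))) / (Real.log R ^ (5 : ℝ) * R ^ 4) := by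
  have hL : 0 < Real.log R := Real.log_pos hR
  rw [gammaFun_eq hR hδ, Real.mul_rpow hL.le (Real.sqrt_nonneg _)]
  have : Real.log R ^ (5 : ℝ) ≠ 0 := by positivity
  field_simp

lemma le_sqrt_of_le {V δ : ℝ} (hV : 0 < V) (hδ : 0 < δ) (h : δ ≤ 4 * Real.pi / V ^ 2) :
    V ≤ √(4 * Real.pi / δ) := by
  apply Real.le_sqrt_of_sq_le
  rw [le_div_iff₀ hδ]
  rw [le_div_iff₀ (by positivity)] at h
  linarith

/-- As `δ` grows, `x = log R · √(4π/δ)` falls, and `x⁵e^{-x}` is decreasing for `x ≥ 5`; `hV5` keeps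
`x` in that range. -/
lemma strictMonoOn_gammaFun {R V : ℝ} (hR : 1 < R) (hV : 0 < V) (hV5 : 5 ≤ Real.log R * V) :
    StrictMonoOn (gammaFun R) (Set.Icc 0 (4 * Real.pi / V ^ 2)) := by
  intro x hx y hy hxy
  rcases eq_or_lt_of_le hx.1 with rfl | hx0
  · rw [gammaFun_zero]
    exact gammaFun_pos hR hxy
  have hy0 : 0 < y := hx0.trans hxy
  have hL : 0 < Real.log R := Real.log_pos hR
  have hR0 : 0 < R := by linarith
  rw [gammaFun_eq' hR hx0, gammaFun_eq' hR hy0]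
  refine div_lt_div_of_pos_right ?_ (by positivity)
  have h1 : √(4 * Real.pi / y) < √(4 * Real.pi / x) := by
    apply Real.sqrt_lt_sqrt (by positivity)
    exact div_lt_div_of_pos_left (by positivity) hx0 hxy
  have h2 := le_sqrt_of_le hV hy0 hy.2
  have h3 : 5 ≤ Real.log R * √(4 * Real.pi / y) :=
    hV5.trans (mul_le_mul_of_nonneg_left h2 hL.le)
  have h4 := mul_lt_mul_of_pos_left h1 hL
  exact strictAntiOn_rpow_mul_exp_neg (by norm_num : (0 : ℝ) < 5) h3 (h3.trans h4.le) h4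

lemma tendsto_gammaFun {R : ℝ} (hR : 1 < R) : Tendsto (gammaFun R) (𝓝[>] 0) (𝓝 0) := by
  have hL : 0 < Real.log R := Real.log_pos hR
  have h1 : Tendsto (fun δ : ℝ => √(4 * Real.pi / δ)) (𝓝[>] 0) atTop := by
    refine Real.tendsto_sqrt_atTop.comp ?_
    exact tendsto_inv_nhdsGT_zero.const_mul_atTop (by positivity)
  have h2 := ((tendsto_rpow_mul_exp_neg_mul_atTop_nhds_zero 5 (Real.log R) hL).comp h1).div_const
    (R ^ 4)
  rw [zero_div] at h2
  refine h2.congr' ?_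
  filter_upwards [self_mem_nhdsWithin] with δ hδ
  rw [gammaFun_eq hR hδ]
  simp [neg_mul]

end RealAnalysis

/-! ### The smoothing property -/

section Smoothing

lemma restrictS2_component_gradiometry {R : ℝ} (hR : 1 < R) (f : L2S2) (m : ℕ) :
    restrictS2 (component m (gradiometry R f)) = gradCoeff R m • restrictS2 (component m f) := by
  apply toL2_injective
  rw [toL2_component, Qproj_gradiometry hR, map_smul, toL2_component]

/-- The bound of the tail of the series for `Tf`. -/
def tailConst (R : ℝ) : ℝ := 6 / (1 - R⁻¹) ^ 4

lemma tailConst_pos {R : ℝ} (hR : 1 < R) : 0 < tailConst R := by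
  have : 0 < 1 - R⁻¹ := sub_pos.mpr (inv_lt_one_of_one_lt₀ hR)
  unfold tailConst
  positivity

/-- The polynomial factor in `j+n` is bounded by a product of one in `j` and one in `n`, so the sum
over `j` gives the constant `tailConst R`. The generous factor `j+3` produces the cubic of
`hasSum_cubic`. -/
lemma abs_tail_term_le {R : ℝ} (hR : 1 < R) (f : L2S2) (x : S2) (n j : ℕ) :
    |gradCoeff R (j + n) * restrictS2 (component (j + n) f) x| ≤
      (((j : ℝ) + 1) * ((j : ℝ) + 2) * ((j : ℝ) + 3) * R⁻¹ ^ j) *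
        (((n : ℝ) + 1) ^ 2 * ((n : ℝ) + 2) / R ^ (n + 3) * ‖f‖) := by
  have h0 := gradCoeff_pos hR (j + n)
  have hR0 : 0 < R := by linarith
  rw [abs_mul, abs_of_pos h0]
  refine (mul_le_mul_of_nonneg_left (abs_component_le (j + n) f x) h0.le).trans ?_
  have hj : (0 : ℝ) ≤ j := by positivity
  have hn : (0 : ℝ) ≤ n := by positivity
  have h1 : (j : ℝ) + n + 1 ≤ (j + 1) * (n + 1) := by nlinarith
  have h2 : (j : ℝ) + n + 2 ≤ (j + 2) * (n + 2) := by nlinarith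
  have h3 : (j : ℝ) + n + 1 ≤ (j + 3) * (n + 1) := by nlinarith
  have h4 : ((j : ℝ) + n + 1) * (j + n + 2) * (j + n + 1) ≤
      ((j + 1) * (n + 1)) * ((j + 2) * (n + 2)) * ((j + 3) * (n + 1)) := by
    gcongr
  calc gradCoeff R (j + n) * ((((j + n : ℕ) : ℝ) + 1) * ‖f‖)
      = (((j : ℝ) + n + 1) * (j + n + 2) * (j + n + 1)) * (R⁻¹ ^ j / R ^ (n + 3) * ‖f‖) := by
        unfold gradCoeff
        push_cast
        rw [show j + n + 3 = j + (n + 3) by ring, pow_add R j, inv_pow]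
        field_simp
    _ ≤ (((j + 1) * (n + 1)) * ((j + 2) * (n + 2)) * ((j + 3) * (n + 1))) *
        (R⁻¹ ^ j / R ^ (n + 3) * ‖f‖) := by gcongr
    _ = _ := by ring

lemma sum_range_odd (n : ℕ) : ∑ m ∈ Finset.range n, (2 * (m : ℝ) + 1) = (n : ℝ) ^ 2 := by
  induction n with
  | zero => simp
  | succ n ih =>
    rw [Finset.sum_range_succ, ih]
    push_cast
    ring

/-- Interpolation between `L¹(S²)` and the smoothness of `Tf`. -/
lemma abs_gradRep_le {R : ℝ} (hR : 1 < R) (f : L2S2) (x : S2) (n : ℕ) :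
    |gradRep R f x| ≤ tailConst R * (((n : ℝ) + 1) ^ 2 * ((n : ℝ) + 2) / R ^ (n + 3) * ‖f‖) +
      (n : ℝ) ^ 2 / (4 * Real.pi) * ∫ y, |gradiometry R f y| ∂surf := by
  have h := (hasSum_gradRep hR f).mapL (ContinuousMap.evalCLM ℝ x)
  simp only [ContinuousMap.evalCLM_apply, ContinuousMap.smul_apply, smul_eq_mul] at h
  have hsplit := h.summable.sum_add_tsum_nat_add n
  rw [h.tsum_eq] at hsplit
  rw [← hsplit, add_comm]
  refine (abs_add_le _ _).trans (add_le_add ?_ ?_)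
  · have hR1 : R⁻¹ < 1 := inv_lt_one_of_one_lt₀ hR
    have hb := (hasSum_cubic (inv_nonneg.mpr (by linarith)) hR1).mul_right
      (((n : ℝ) + 1) ^ 2 * ((n : ℝ) + 2) / R ^ (n + 3) * ‖f‖)
    rw [← Real.norm_eq_abs]
    exact tsum_of_norm_bounded hb fun j => abs_tail_term_le hR f x n j
  · refine (Finset.abs_sum_le_sum_abs _ _).trans ?_
    -- Low-degree terms are components of `Tf` itself, so the `L¹` kernel bound applies without
    -- inverting `T`.
    have hterm : ∀ m ∈ Finset.range n, |gradCoeff R m * restrictS2 (component m f) x| ≤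
        (2 * m + 1) / (4 * Real.pi) * ∫ y, |gradiometry R f y| ∂surf := by
      intro m _
      have h1 := abs_component_le_integral m (gradiometry R f) x
      rwa [restrictS2_component_gradiometry hR] at h1
    refine (Finset.sum_le_sum hterm).trans (le_of_eq ?_)
    rw [← Finset.sum_mul, ← Finset.sum_div]
    rw [sum_range_odd]

/-- With `v = √(4π/δ)` and `n = ⌊v⌋`, the inequality `v < n+1` gives `R^{-n-3} ≤ R^{-v-2}`, and the
cubic in `n` is at most `12v³`. Compared with `v⁵R^{-v-4}` there is `v²` to spare, which absorbs `12
· tailConst R · R²`. -/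
lemma tail_le_gammaFun {R δ : ℝ} (hR : 1 < R) (hδ : 0 < δ) (h1 : 1 ≤ √(4 * Real.pi / δ))
    (h2 : 12 * tailConst R * R ^ 2 ≤ √(4 * Real.pi / δ)) :
    tailConst R * (((⌊√(4 * Real.pi / δ)⌋₊ : ℝ) + 1) ^ 2 * ((⌊√(4 * Real.pi / δ)⌋₊ : ℝ) + 2) /
      R ^ (⌊√(4 * Real.pi / δ)⌋₊ + 3)) ≤ gammaFun R δ := by
  rw [gammaFun_eq hR hδ]
  set v := √(4 * Real.pi / δ)
  set n := ⌊v⌋₊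
  have hR0 : 0 < R := by linarith
  have hS := tailConst_pos hR
  have hnv : (n : ℝ) ≤ v := Nat.floor_le (by linarith)
  have hvn : v < n + 1 := Nat.lt_floor_add_one v
  have h3 : Real.exp (Real.log R * v) ≤ R ^ (n + 1) := by
    rw [← Real.rpow_def_of_pos hR0, ← Real.rpow_natCast]
    apply Real.rpow_le_rpow_of_exponent_le hR.le
    push_cast
    exact hvn.le
  have h4 : Real.exp (Real.log R * v) * R ^ 2 ≤ R ^ (n + 3) := by
    rw [show n + 3 = (n + 1) + 2 by ring, pow_add R (n + 1)]
    gcongr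
  have h5 : ((n : ℝ) + 1) ^ 2 * ((n : ℝ) + 2) ≤ 12 * v ^ 3 := by
    have : ((n : ℝ) + 1) ^ 2 * ((n : ℝ) + 2) ≤ (2 * v) ^ 2 * (3 * v) := by
      gcongr <;> linarith
    linarith
  have h6 : 12 * tailConst R * R ^ 2 ≤ v ^ 2 := by nlinarith
  have h7 : v ^ (5 : ℝ) = v ^ 5 := by norm_cast
  have hE := Real.exp_pos (Real.log R * v)
  rw [h7, Real.exp_neg]
  calc tailConst R * (((n : ℝ) + 1) ^ 2 * ((n : ℝ) + 2) / R ^ (n + 3))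
      ≤ tailConst R * (12 * v ^ 3 / (Real.exp (Real.log R * v) * R ^ 2)) := by gcongr
    _ = (12 * tailConst R * R ^ 2) * (v ^ 3 * (Real.exp (Real.log R * v))⁻¹ / R ^ 4) := by
        field_simp
    _ ≤ v ^ 2 * (v ^ 3 * (Real.exp (Real.log R * v))⁻¹ / R ^ 4) := by gcongr
    _ = v ^ 5 * (Real.exp (Real.log R * v))⁻¹ / R ^ 4 := by ring

lemma gradiometry_sub_ae {R : ℝ} (f u : L2S2) :
    (fun y => gradiometry R f y - gradiometry R u y) =ᵐ[surf] gradiometry R (f - u) := by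
  rw [map_sub]
  exact (Lp.coeFn_sub _ _).symm

lemma eLpNorm_one_eq (f : L2S2) : eLpNorm f 1 surf = ENNReal.ofReal (∫ y, |f y| ∂surf) := by
  rw [eLpNorm_one_eq_lintegral_enorm]
  simp only [← Real.norm_eq_abs]
  exact (ofReal_integral_norm_eq_lintegral_enorm (integrable_L2S2 f)).symm

lemma eLpNorm_top_gradiometry_le {R δ : ℝ} (hR : 1 < R) (hδ : 0 < δ)
    (h1 : 1 ≤ √(4 * Real.pi / δ)) (h2 : 12 * tailConst R * R ^ 2 ≤ √(4 * Real.pi / δ))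
    (f : L2S2) :
    eLpNorm (gradiometry R f) ⊤ surf ≤ ENNReal.ofReal (gammaFun R δ * ‖f‖) +
      ENNReal.ofReal (1 / δ) * eLpNorm (gradiometry R f) 1 surf := by
  have hI : 0 ≤ ∫ y, |gradiometry R f y| ∂surf := integral_nonneg fun _ => abs_nonneg _
  rw [eLpNorm_one_eq, ← ENNReal.ofReal_mul (by positivity),
    ← ENNReal.ofReal_add (mul_nonneg (gammaFun_pos hR hδ).le (norm_nonneg _)) (by positivity),
    eLpNorm_exponent_top]
  apply eLpNormEssSup_le_of_ae_bound
  filter_upwards [gradRep_ae_eq hR f] with y hy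
  rw [← hy, Real.norm_eq_abs]
  refine (abs_gradRep_le hR f y ⌊√(4 * Real.pi / δ)⌋₊).trans ?_
  rw [← mul_assoc]
  refine add_le_add (mul_le_mul_of_nonneg_right (tail_le_gammaFun hR hδ h1 h2) (norm_nonneg _))
    (mul_le_mul_of_nonneg_right ?_ hI)
  have h3 : (⌊√(4 * Real.pi / δ)⌋₊ : ℝ) ^ 2 ≤ 4 * Real.pi / δ := by
    conv_rhs => rw [← Real.sq_sqrt (show 0 ≤ 4 * Real.pi / δ by positivity)]
    exact pow_le_pow_left₀ (by positivity) (Nat.floor_le (Real.sqrt_nonneg _)) 2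
  rw [div_le_iff₀ (by positivity)]
  refine h3.trans (le_of_eq ?_)
  ring

/-- The smoothing property of the gradiometry operator. -/
lemma exists_smoothingProperty {R : ℝ} (hR : 1 < R) : ∃ δ₀ : ℝ, ∀ u : L2S2,
    ∀ ξ : StrongDual ℝ L2S2, IsSubgradient (fun f : L2S2 => ‖f‖ ^ 2) u ξ →
      SmoothingProperty surf (fun f : L2S2 => ⇑(gradiometry R f)) (fun f : L2S2 => ‖f‖ ^ 2)
        u ξ 2 δ₀ (gammaFun R) := by
  have hL : 0 < Real.log R := Real.log_pos hR
  have hS := tailConst_pos hR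
  -- The three summands are the lower bounds needed for `√(4π/δ)`: `1` and the last for the tail
  -- estimate, `5 / log R` for monotonicity of `γ`. The condition `δ ≤ 4π/V²` says that `√(4π/δ) ≥
  -- V`.
  set V := 1 + 5 / Real.log R + 12 * tailConst R * R ^ 2 with hV
  have hV0 : 0 < V := by positivity
  have h5 : 0 < 5 / Real.log R := by positivity
  have hT : 0 < 12 * tailConst R * R ^ 2 := by positivity
  have hV5 : 5 ≤ Real.log R * V := by
    have : Real.log R * (5 / Real.log R) = 5 := by field_simp
    nlinarith
  refine ⟨4 * Real.pi / V ^ 2, fun u ξ hξ => ?_⟩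
  refine ⟨fun f => (Lp.memLp _).mono_exponent (by norm_num), convexOn_norm_sq, ?_, by positivity,
    by norm_num, ?_, strictMonoOn_gammaFun hR hV0 hV5, tendsto_gammaFun hR, ?_⟩
  · exact (continuous_norm.pow 2).lowerSemicontinuous
  · intro δ hδ
    rcases eq_or_lt_of_le hδ.1 with rfl | h
    · rw [gammaFun_zero]
    · exact (gammaFun_pos hR h).le
  · intro δ hδ hδ₀ f
    have hv := le_sqrt_of_le hV0 hδ hδ₀
    rw [eLpNorm_congr_ae (gradiometry_sub_ae f u), eLpNorm_congr_ae (gradiometry_sub_ae f u),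
      bregman_norm_sq hξ, ← Real.sqrt_eq_rpow, Real.sqrt_sq (norm_nonneg _)]
    exact eLpNorm_top_gradiometry_le hR hδ (by linarith) (by linarith) (f - u)

end Smoothing

end

noncomputable section

/-! ### Concavity of the logarithmic function and the balancing argument -/

section LogIndex

variable {s : ℝ}

lemma logIndex_zero : logIndex s 0 = 0 := by simp [logIndex]

lemma logIndex_of_le {t : ℝ} (h0 : 0 < t) (h : t ≤ Real.exp (-(s + 1))) :
    logIndex s t = (-Real.log t) ^ (-s) := by
  rw [logIndex, if_neg (not_le.mpr h0), if_pos h]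

lemma logIndex_of_ge (hs : 0 < s) {t : ℝ} (h : Real.exp (-(s + 1)) ≤ t) :
    logIndex s t = (s + 1) ^ (-s - 1) * (1 + s * Real.exp (s + 1) * t) := by
  have h0 : 0 < t := (Real.exp_pos _).trans_le h
  rcases eq_or_lt_of_le h with rfl | h
  · rw [logIndex_of_le h0 le_rfl, Real.log_exp, neg_neg, mul_assoc, ← Real.exp_add, add_neg_cancel,
      Real.exp_zero, mul_one, add_comm 1 s]
    have h1 : 0 < s + 1 := by linarith
    conv_rhs => rw [← Real.rpow_one (s + 1), ← Real.rpow_mul h1.le, one_mul, ← Real.rpow_add h1]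
    congr 1
    ring
  · rw [logIndex, if_neg (not_le.mpr h0), if_neg (not_le.mpr h)]

/-- The derivative of `t ↦ (-ln t)^{-s}`. -/
def logSlope (s t : ℝ) : ℝ := s * ((-Real.log t) ^ (s + 1) * t)⁻¹

lemma logSlope_at (hs : 0 < s) :
    logSlope s (Real.exp (-(s + 1))) = (s + 1) ^ (-s - 1) * (s * Real.exp (s + 1)) := by
  rw [logSlope, Real.log_exp, neg_neg, mul_inv, Real.exp_neg, inv_inv,
    show -s - 1 = -(s + 1) by ring, Real.rpow_neg (by linarith)]
  ring

lemma neg_log_ge {t : ℝ} (h0 : 0 < t) (h : t ≤ Real.exp (-(s + 1))) : s + 1 ≤ -Real.log t := by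
  have := (Real.log_le_iff_le_exp h0).mpr h
  linarith

lemma hasDerivAt_neg_log_rpow (hs : 0 < s) {t : ℝ} (h0 : 0 < t) (h : t ≤ Real.exp (-(s + 1))) :
    HasDerivAt (fun t => (-Real.log t) ^ (-s)) (logSlope s t) t := by
  have hL := neg_log_ge h0 h
  have hL0 : 0 < -Real.log t := by linarith
  have h1 := ((Real.hasDerivAt_log h0.ne').neg).rpow_const (p := -s) (Or.inl hL0.ne')
  refine h1.congr_deriv ?_
  rw [logSlope, show -s - 1 = -(s + 1) by ring, Real.rpow_neg (by exact hL0.le), mul_inv]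
  simp only [Pi.neg_apply]
  ring

/-- The continuation is by the tangent, so the slope stays frozen beyond the break point; there the
two one-sided derivatives are glued. -/
lemma hasDerivAt_logIndex (hs : 0 < s) {t : ℝ} (h0 : 0 < t) :
    HasDerivAt (logIndex s) (logSlope s (min t (Real.exp (-(s + 1))))) t := by
  have hlin : ∀ t : ℝ, HasDerivAt (fun t => (s + 1) ^ (-s - 1) * (1 + s * Real.exp (s + 1) * t))
      ((s + 1) ^ (-s - 1) * (s * Real.exp (s + 1))) t := by
    intro t
    have := (((hasDerivAt_id t).const_mul (s * Real.exp (s + 1))).const_add 1).const_mul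
      ((s + 1) ^ (-s - 1))
    simpa using this
  rcases lt_trichotomy t (Real.exp (-(s + 1))) with h | rfl | h
  · rw [min_eq_left h.le]
    refine (hasDerivAt_neg_log_rpow hs h0 h.le).congr_of_eventuallyEq ?_
    filter_upwards [Ioo_mem_nhds h0 h] with y hy
    exact logIndex_of_le hy.1 hy.2.le
  · rw [min_self]
    have hl : HasDerivWithinAt (logIndex s) (logSlope s (Real.exp (-(s + 1))))
        (Set.Iic (Real.exp (-(s + 1)))) (Real.exp (-(s + 1))) := by
      refine (hasDerivAt_neg_log_rpow hs h0 le_rfl).hasDerivWithinAt.congr_of_eventuallyEq ?_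
        (logIndex_of_le h0 le_rfl)
      filter_upwards [self_mem_nhdsWithin, mem_nhdsWithin_of_mem_nhds (Ioi_mem_nhds h0)]
        with y hy hy'
      exact logIndex_of_le hy' hy
    have hr : HasDerivWithinAt (logIndex s) (logSlope s (Real.exp (-(s + 1))))
        (Set.Ici (Real.exp (-(s + 1)))) (Real.exp (-(s + 1))) := by
      rw [logSlope_at hs]
      exact (hlin _).hasDerivWithinAt.congr (fun y hy => logIndex_of_ge hs hy)
        (logIndex_of_ge hs le_rfl)
    have := hl.union hr
    rwa [Set.Iic_union_Ici, hasDerivWithinAt_univ] at this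
  · rw [min_eq_right h.le, logSlope_at hs]
    refine (hlin t).congr_of_eventuallyEq ?_
    filter_upwards [Ioi_mem_nhds h] with y hy
    exact logIndex_of_ge hs (le_of_lt hy)

lemma logSlope_pos (hs : 0 < s) {t : ℝ} (h0 : 0 < t) (h : t ≤ Real.exp (-(s + 1))) :
    0 < logSlope s t := by
  have hL := neg_log_ge h0 h
  have hL0 : 0 < -Real.log t := by linarith
  unfold logSlope
  positivity

/-- With `x = -log t` the denominator of the slope is `x^{s+1}e^{-x}`, decreasing in `x ≥ s+1` and
hence increasing in `t`. -/
lemma logSlope_antitoneOn (hs : 0 < s) :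
    AntitoneOn (logSlope s) (Set.Ioc 0 (Real.exp (-(s + 1)))) := by
  intro t ht u hu htu
  have hLt := neg_log_ge ht.1 ht.2
  have hLu := neg_log_ge hu.1 hu.2
  have hLL : -Real.log u ≤ -Real.log t := neg_le_neg (Real.log_le_log ht.1 htu)
  have h1 := (strictAntiOn_rpow_mul_exp_neg (show 0 < s + 1 by linarith)).antitoneOn hLu hLt hLL
  simp only [neg_neg, Real.exp_log ht.1, Real.exp_log hu.1] at h1
  have h2 : 0 < (-Real.log t) ^ (s + 1) * t := by
    have : 0 < -Real.log t := by linarith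
    exact mul_pos (Real.rpow_pos_of_pos this _) ht.1
  unfold logSlope
  gcongr

lemma continuousOn_logIndex (hs : 0 < s) : ContinuousOn (logIndex s) (Set.Ici 0) := by
  intro t ht
  rcases eq_or_lt_of_le (show 0 ≤ t from ht) with rfl | h
  · rw [← continuousWithinAt_Ioi_iff_Ici, ContinuousWithinAt, logIndex_zero]
    have h1 := (tendsto_rpow_neg_atTop hs).comp
      (tendsto_neg_atBot_atTop.comp Real.tendsto_log_nhdsGT_zero)
    refine h1.congr' ?_
    filter_upwards [Ioc_mem_nhdsGT (Real.exp_pos (-(s + 1)))] with y hy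
    rw [logIndex_of_le hy.1 hy.2]
    rfl
  · exact (hasDerivAt_logIndex hs h).continuousAt.continuousWithinAt

lemma concaveOn_logIndex (hs : 0 < s) : ConcaveOn ℝ (Set.Ici 0) (logIndex s) := by
  refine AntitoneOn.concaveOn_of_deriv (convex_Ici 0) (continuousOn_logIndex hs) ?_ ?_
  · rw [interior_Ici]
    exact fun t ht => (hasDerivAt_logIndex hs ht).differentiableAt.differentiableWithinAt
  · rw [interior_Ici]
    intro t ht u hu htu
    rw [(hasDerivAt_logIndex hs ht).deriv, (hasDerivAt_logIndex hs hu).deriv]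
    exact logSlope_antitoneOn hs ⟨lt_min ht (Real.exp_pos _), min_le_right _ _⟩
      ⟨lt_min hu (Real.exp_pos _), min_le_right _ _⟩ (min_le_min_right _ htu)

lemma strictMonoOn_logIndex (hs : 0 < s) : StrictMonoOn (logIndex s) (Set.Ici 0) := by
  refine strictMonoOn_of_deriv_pos (convex_Ici 0) (continuousOn_logIndex hs) fun t ht => ?_
  rw [interior_Ici] at ht
  rw [(hasDerivAt_logIndex hs ht).deriv]
  exact logSlope_pos hs (lt_min ht (Real.exp_pos _)) (min_le_right _ _)

/-- Raise `x ≤ e^x` at `x = L/(2s)` to the power `s`. -/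
lemma exp_neg_half_le (hs : 0 < s) {L : ℝ} (hL : 0 < L) :
    Real.exp (-(L / 2)) ≤ (2 * s) ^ s * L ^ (-s) := by
  have h1 : L / (2 * s) ≤ Real.exp (L / (2 * s)) := by
    have := Real.add_one_le_exp (L / (2 * s))
    linarith
  have h2 := Real.rpow_le_rpow (by positivity) h1 hs.le
  rw [← Real.exp_mul, show L / (2 * s) * s = L / 2 by field_simp,
    Real.div_rpow hL.le (by positivity)] at h2
  rw [Real.exp_neg, Real.rpow_neg hL.le]
  have h3 : 0 < L ^ s := by positivity
  have h4 : 0 < (2 * s) ^ s := by positivity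
  have h5 : ((2 * s) ^ s * (L ^ s)⁻¹) = (L ^ s / (2 * s) ^ s)⁻¹ := by field_simp
  rw [h5]
  exact inv_anti₀ (by positivity) h2

/-- Balancing the terms `n^{-s}` and `R^n τ`. -/
lemma exists_le_logIndex (hs : 0 < s) {A B R : ℝ} (hA : 0 ≤ A) (hB : 0 ≤ B) (hR : 1 < R) :
    ∃ β' : ℝ, 0 < β' ∧ ∀ τ : ℝ, 0 ≤ τ → ∀ y : ℝ,
      (∀ n : ℕ, 1 ≤ n → y ≤ A * (n : ℝ) ^ (-s) + B * (R ^ n * τ)) → y ≤ β' * logIndex s τ := by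
  have hlog : 0 < Real.log R := Real.log_pos hR
  have hR0 : 0 < R := by linarith
  set c := (s + 1) ^ (-s - 1) with hc
  have hc0 : 0 < c := by positivity
  set d := s * Real.exp (s + 1) with hd
  have hd0 : 0 < d := by positivity
  set b1 := A * (2 * Real.log R) ^ s + B * (R * (2 * s) ^ s) with hb1
  set b2 := A / c + B * R / (c * d) with hb2
  have hb1' : 0 ≤ b1 := by positivity
  have hb2' : 0 ≤ b2 := by positivity
  -- The summand `1` keeps `β'` positive when `A = B = 0`; `b1` serves small `τ` and `b2` large `τ`.
  refine ⟨1 + b1 + b2, by positivity, fun τ hτ y hy => ?_⟩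
  rcases eq_or_lt_of_le hτ with rfl | hτ0
  · rw [logIndex_zero, mul_zero]
    have h1 : Tendsto (fun n : ℕ => A * (n : ℝ) ^ (-s)) atTop (𝓝 (A * 0)) :=
      ((tendsto_rpow_neg_atTop hs).comp tendsto_natCast_atTop_atTop).const_mul A
    rw [mul_zero] at h1
    refine ge_of_tendsto h1 ?_
    filter_upwards [eventually_ge_atTop 1] with n hn
    simpa using hy n hn
  have hpos : 0 ≤ logIndex s τ := by
    rw [← logIndex_zero (s := s)]
    exact (strictMonoOn_logIndex hs).monotoneOn (Set.mem_Ici.mpr le_rfl) hτ hτ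
  rcases le_total τ (Real.exp (-(s + 1))) with h | h
  · have key : y ≤ b1 * logIndex s τ := by
      rw [logIndex_of_le hτ0 h]
      have hL := neg_log_ge hτ0 h
      set L := -Real.log τ with hLdef
      have hL0 : 0 < L := by linarith
      have hx0 : 0 < L / (2 * Real.log R) := by positivity
      -- With this `n`, `R^n ≤ R τ^{-1/2}`, so `R^n τ ≤ R√τ`, which is smaller than a multiple of
      -- `L^{-s}`; and `n^{-s}` is itself at most a multiple of `L^{-s}`.
      refine (hy ⌈L / (2 * Real.log R)⌉₊ (Nat.one_le_ceil_iff.mpr hx0)).trans ?_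
      have hn1 := Nat.le_ceil (L / (2 * Real.log R))
      have hn2 := Nat.ceil_lt_add_one hx0.le
      set n := ⌈L / (2 * Real.log R)⌉₊
      have e1 : (n : ℝ) ^ (-s) ≤ (2 * Real.log R) ^ s * L ^ (-s) := by
        refine (Real.rpow_le_rpow_of_nonpos hx0 hn1 (by linarith)).trans (le_of_eq ?_)
        rw [Real.div_rpow hL0.le (by positivity), Real.rpow_neg (x := 2 * Real.log R) (by positivity),
          div_inv_eq_mul, mul_comm]
      have e2 : R ^ n * τ ≤ R * ((2 * s) ^ s * L ^ (-s)) := by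
        have e3 : R ^ n ≤ R * Real.exp (L / 2) := by
          calc R ^ n = R ^ (n : ℝ) := (Real.rpow_natCast _ _).symm
            _ ≤ R ^ (L / (2 * Real.log R) + 1) := Real.rpow_le_rpow_of_exponent_le hR.le hn2.le
            _ = R * Real.exp (L / 2) := by
              rw [Real.rpow_add hR0, Real.rpow_one, Real.rpow_def_of_pos hR0, mul_comm]
              congr 2
              field_simp
        have e4 : τ = Real.exp (-L) := by rw [hLdef, neg_neg, Real.exp_log hτ0]
        calc R ^ n * τ ≤ R * Real.exp (L / 2) * Real.exp (-L) := by
              rw [← e4]; exact mul_le_mul_of_nonneg_right e3 hτ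
          _ = R * Real.exp (-(L / 2)) := by
              rw [mul_assoc, ← Real.exp_add]; congr 2; ring
          _ ≤ R * ((2 * s) ^ s * L ^ (-s)) := by
              gcongr
              exact exp_neg_half_le hs hL0
      calc A * (n : ℝ) ^ (-s) + B * (R ^ n * τ)
          ≤ A * ((2 * Real.log R) ^ s * L ^ (-s)) + B * (R * ((2 * s) ^ s * L ^ (-s))) := by gcongr
        _ = b1 * L ^ (-s) := by rw [hb1]; ring
    nlinarith
  · have key : y ≤ b2 * logIndex s τ := by
      rw [logIndex_of_ge hs h]
      -- Away from zero no balancing is needed: `n = 1` gives an affine bound in `τ`, dominated by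
      -- the affine branch of `logIndex`.
      have h1 := hy 1 le_rfl
      rw [Nat.cast_one, Real.one_rpow, mul_one, pow_one] at h1
      have h2 : b2 * (c * (1 + d * τ)) = A + B * (R * τ) + (A * d * τ + B * R / d) := by
        rw [hb2]
        field_simp
        ring
      rw [h2]
      have : 0 ≤ A * d * τ + B * R / d := by positivity
      linarith
    nlinarith

end LogIndex

/-! ### The variational source condition -/

section SourceCondition

lemma hasSum_inner_Qproj (u h : L2S2) : HasSum (fun m => inner ℝ (Qproj m u) h) (inner ℝ u h) :=
  (hasSum_Qproj u).mapL ((innerSL ℝ).flip h)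

lemma inner_Qproj_Qproj (m : ℕ) (u h : L2S2) :
    inner ℝ (Qproj m u) h = inner ℝ (Qproj m u) (Qproj m h) := by
  rw [← inner_Qproj_left, Qproj_of_mem (Qproj_mem m u)]

lemma hasSum_norm_sq_Qproj (h : L2S2) : HasSum (fun m => ‖Qproj m h‖ ^ 2) (‖h‖ ^ 2) := by
  have h1 := hasSum_inner_Qproj h h
  simp only [inner_Qproj_Qproj, real_inner_self_eq_norm_sq] at h1
  exact h1

/-- Inverting `T` on degree `m` costs `R^{m+3}/((m+1)(m+2))`. Weakening the kernel bound
`(2m+1)/(4π)` to `(m+1)(m+2)` cancels the polynomial factor; `‖toL2‖` converts the sup norm to the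
`L²` norm. -/
lemma norm_Qproj_le_integral {R : ℝ} (hR : 1 < R) (h : L2S2) (m : ℕ) :
    ‖Qproj m h‖ ≤ ‖toL2‖ * R ^ 3 * (R ^ m * ∫ y, |gradiometry R h y| ∂surf) := by
  have hI : 0 ≤ ∫ y, |gradiometry R h y| ∂surf := integral_nonneg fun _ => abs_nonneg _
  set I := ∫ y, |gradiometry R h y| ∂surf
  have ha := gradCoeff_pos hR m
  have hR0 : 0 < R := by linarith
  have hm : (0 : ℝ) ≤ m := by positivity
  have h1 : ‖restrictS2 (component m (gradiometry R h))‖ ≤ ((m : ℝ) + 1) * (m + 2) * I := by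
    refine (ContinuousMap.norm_le _ (by positivity)).mpr fun x =>
      (abs_component_le_integral m _ x).trans ?_
    refine mul_le_mul_of_nonneg_right ?_ hI
    rw [div_le_iff₀ (by positivity)]
    nlinarith [Real.pi_gt_three, mul_nonneg hm hm]
  have h2 : gradCoeff R m * ‖Qproj m h‖ ≤ ‖toL2‖ * (((m : ℝ) + 1) * (m + 2) * I) := by
    have h3 : ‖Qproj m (gradiometry R h)‖ = gradCoeff R m * ‖Qproj m h‖ := by
      rw [Qproj_gradiometry hR, norm_smul, Real.norm_of_nonneg ha.le]
    rw [← h3, ← toL2_component]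
    refine (toL2.le_opNorm _).trans ?_
    gcongr
  have h4 : ‖toL2‖ * (((m : ℝ) + 1) * (m + 2) * I) =
      gradCoeff R m * (‖toL2‖ * R ^ 3 * (R ^ m * I)) := by
    unfold gradCoeff
    rw [pow_add]
    field_simp
  rw [h4] at h2
  exact le_of_mul_le_mul_left h2 ha

lemma norm_sq_Qproj_le {p : ℝ} (hp : 0 < p) (u : L2S2) {n m : ℕ} (hn : 1 ≤ n) (hm : n ≤ m) :
    ‖Qproj m u‖ ^ 2 ≤ (n : ℝ) ^ (-(2 * p)) *
      ((1 + (m : ℝ) * ((m : ℝ) + 1)) ^ p * ‖Qproj m u‖ ^ 2) := by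
  have hn0 : (0 : ℝ) < n := by exact_mod_cast hn
  have hnm : (n : ℝ) ≤ m := by exact_mod_cast hm
  have h1 : (n : ℝ) ^ (2 * p) ≤ (1 + (m : ℝ) * ((m : ℝ) + 1)) ^ p := by
    rw [Real.rpow_mul hn0.le]
    refine Real.rpow_le_rpow (by positivity) ?_ hp.le
    norm_cast
    nlinarith
  have h2 : 1 ≤ (n : ℝ) ^ (-(2 * p)) * (1 + (m : ℝ) * ((m : ℝ) + 1)) ^ p := by
    rw [Real.rpow_neg hn0.le, inv_mul_eq_div, one_le_div (by positivity)]
    exact h1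
  rw [← mul_assoc]
  exact le_mul_of_one_le_left (sq_nonneg _) h2

/-- The inequality is proved degree by degree and summed. Below `n`, Cauchy–Schwarz and
`norm_Qproj_le_integral` give a geometric sum. From `n` on, `2ab ≤ 2a² + b²/2` charges half of
`‖Qproj m h‖²` to the left side and pays for `‖Qproj m u‖²` by the Sobolev decay. -/
lemma neg_inner_le {R p : ℝ} (hR : 1 < R) (hp : 0 < p) {u : L2S2} (hu : MemSobolev p u)
    (h : L2S2) {n : ℕ} (hn : 1 ≤ n) :
    -(2 * inner ℝ u h) - 1 / 2 * ‖h‖ ^ 2 ≤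
      (2 * ∑' m : ℕ, (1 + (m : ℝ) * ((m : ℝ) + 1)) ^ p * ‖Qproj m u‖ ^ 2) * (n : ℝ) ^ (-(2 * p)) +
      2 * ‖u‖ * ‖toL2‖ * R ^ 3 / (R - 1) * (R ^ n * ∫ y, |gradiometry R h y| ∂surf) := by
  have hI : 0 ≤ ∫ y, |gradiometry R h y| ∂surf := integral_nonneg fun _ => abs_nonneg _
  set I := ∫ y, |gradiometry R h y| ∂surf with hIdef
  have hR0 : 0 < R := by linarith
  have s1 := (hasSum_inner_Qproj u h).mul_left (-2)
  have s2 := (hasSum_norm_sq_Qproj h).mul_left (1 / 2)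
  have s3 := (Summable.hasSum hu).mul_left (2 * (n : ℝ) ^ (-(2 * p)))
  -- The low-degree bound is extended by zero to a series so that it enters the termwise comparison.
  have s4 : HasSum (fun m => if m ∈ Finset.range n then
      2 * ‖u‖ * (‖toL2‖ * R ^ 3 * (R ^ m * I)) else 0)
      (∑ m ∈ Finset.range n, if m ∈ Finset.range n then
        2 * ‖u‖ * (‖toL2‖ * R ^ 3 * (R ^ m * I)) else 0) :=
    hasSum_sum_of_ne_finset_zero fun m hm => if_neg hm
  have key := hasSum_le (fun m => ?_) s1 ((s2.add s3).add s4)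
  · have h5 : (∑ m ∈ Finset.range n, if m ∈ Finset.range n then
        2 * ‖u‖ * (‖toL2‖ * R ^ 3 * (R ^ m * I)) else 0) ≤
        2 * ‖u‖ * ‖toL2‖ * R ^ 3 / (R - 1) * (R ^ n * I) := by
      have hR1 : 0 < R - 1 := by linarith
      have hgeom : ∑ m ∈ Finset.range n, R ^ m ≤ R ^ n / (R - 1) := by
        rw [geom_sum_eq hR.ne']
        gcongr
        linarith
      calc (∑ m ∈ Finset.range n, if m ∈ Finset.range n then
            2 * ‖u‖ * (‖toL2‖ * R ^ 3 * (R ^ m * I)) else 0)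
          = 2 * ‖u‖ * ‖toL2‖ * R ^ 3 * I * ∑ m ∈ Finset.range n, R ^ m := by
            rw [Finset.mul_sum]
            refine Finset.sum_congr rfl fun m hm => ?_
            rw [if_pos hm]
            ring
        _ ≤ 2 * ‖u‖ * ‖toL2‖ * R ^ 3 * I * (R ^ n / (R - 1)) := by gcongr
        _ = _ := by ring
    linarith
  · have hcs : -2 * inner ℝ (Qproj m u) h ≤ 2 * (‖Qproj m u‖ * ‖Qproj m h‖) := by
      rw [inner_Qproj_Qproj]
      have := (abs_le.mp (abs_real_inner_le_norm (Qproj m u) (Qproj m h))).1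
      linarith
    refine hcs.trans ?_
    by_cases hm : m ∈ Finset.range n
    · rw [if_pos hm]
      have h6 : ‖Qproj m u‖ * ‖Qproj m h‖ ≤ ‖u‖ * (‖toL2‖ * R ^ 3 * (R ^ m * I)) :=
        mul_le_mul (norm_Qproj_le m u) (norm_Qproj_le_integral hR h m) (norm_nonneg _)
          (norm_nonneg _)
      have h7 : 0 ≤ 1 / 2 * ‖Qproj m h‖ ^ 2 + 2 * (n : ℝ) ^ (-(2 * p)) *
          ((1 + (m : ℝ) * ((m : ℝ) + 1)) ^ p * ‖Qproj m u‖ ^ 2) := by positivity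
      linarith
    · rw [if_neg hm, add_zero]
      have h8 := norm_sq_Qproj_le hp u hn (by simpa using hm)
      nlinarith [sq_nonneg (2 * ‖Qproj m u‖ - ‖Qproj m h‖)]

/-- The variational source condition for the gradiometry operator. -/
lemma exists_variationalSourceCondition {R p : ℝ} (hR : 1 < R) (hp : 0 < p) {u : L2S2}
    (hu : MemSobolev p u) {ξ : StrongDual ℝ L2S2}
    (hξ : IsSubgradient (fun f : L2S2 => ‖f‖ ^ 2) u ξ) (D : Set L2S2) :
    ∃ β β' : ℝ, 0 < β' ∧
      VariationalSourceCondition surf (fun f : L2S2 => ⇑(gradiometry R f)) D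
        (fun f : L2S2 => ‖f‖ ^ 2) u ξ 1 β (fun τ => β' * logIndex (2 * p) τ) := by
  have hs : 0 < 2 * p := by positivity
  have hR1 : 0 < R - 1 := by linarith
  have hR0 : 0 < R := by linarith
  obtain ⟨β', hβ', key⟩ := exists_le_logIndex hs
    (A := 2 * ∑' m : ℕ, (1 + (m : ℝ) * ((m : ℝ) + 1)) ^ p * ‖Qproj m u‖ ^ 2)
    (B := 2 * ‖u‖ * ‖toL2‖ * R ^ 3 / (R - 1)) (mul_nonneg zero_le_two (tsum_nonneg fun m => by
      positivity)) (by positivity) hR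
  -- Half of `‖f - u‖²` is spent in `neg_inner_le`; the other half is what `β = 1/2` keeps.
  refine ⟨1 / 2, β', hβ', ?_, by norm_num, ?_, ?_, ?_, ?_⟩
  · intro f _
    rw [ENNReal.ofReal_one]
    exact (Lp.memLp _).mono_exponent (by norm_num)
  · simpa using (concaveOn_logIndex hs).smul hβ'.le
  · intro x hx y hy hxy
    exact mul_lt_mul_of_pos_left (strictMonoOn_logIndex hs hx hy hxy) hβ'
  · simp [logIndex_zero]
  · intro f _
    have hI : 0 ≤ ∫ y, |gradiometry R (f - u) y| ∂surf := integral_nonneg fun _ => abs_nonneg _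
    rw [bregman_norm_sq hξ, ENNReal.ofReal_one, eLpNorm_congr_ae (gradiometry_sub_ae f u),
      eLpNorm_one_eq, ENNReal.toReal_ofReal hI, Real.rpow_one]
    have h1 := key _ hI _ fun n hn => neg_inner_le hR hp hu (f - u) hn
    have h2 : ‖f‖ ^ 2 - ‖u‖ ^ 2 = ‖f - u‖ ^ 2 + 2 * inner ℝ u (f - u) := by
      rw [inner_sub_right, norm_sub_sq_real, real_inner_self_eq_norm_sq, real_inner_comm]
      ring
    linarith

end SourceCondition

end

theorem lemma4p3 :
    -- boundedness from `L²(S²)` to `A^λ(S²)`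
    (∀ R : ℝ, 1 < R → ∃ K : ℝ, ∀ f : L2S2, ∃ g : C(S2, ℝ),
      (⇑g =ᵐ[surf] ⇑(gradiometry R f)) ∧ MemSphereA (gradWeight R) g ∧
        sphereNorm (gradWeight R) g ≤ ENNReal.ofReal (K * ‖f‖)) ∧
    -- the smoothing property, with a constant that does not depend on `R`
    (∃ C : ℝ, 0 < C ∧ ∀ R : ℝ, 1 < R → ∃ δ₀ : ℝ, ∀ u : L2S2, ∀ ξ : StrongDual ℝ L2S2,
      IsSubgradient (fun f : L2S2 => ‖f‖ ^ 2) u ξ →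
        SmoothingProperty surf (fun f : L2S2 => ⇑(gradiometry R f)) (fun f : L2S2 => ‖f‖ ^ 2)
          u ξ 2 δ₀
          (fun δ => C * δ ^ (-(5 / 2) : ℝ) * R ^ (-√(4 * Real.pi / δ) - 4))) ∧
    -- the variational source condition
    (∀ R : ℝ, 1 < R → ∀ p : ℝ, 0 < p → ∀ u : L2S2, MemSobolev p u →
      ∀ ξ : StrongDual ℝ L2S2, IsSubgradient (fun f : L2S2 => ‖f‖ ^ 2) u ξ →
        ∀ D : Set L2S2, Bornology.IsBounded D → ∃ β β' : ℝ, 0 < β' ∧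
          VariationalSourceCondition surf (fun f : L2S2 => ⇑(gradiometry R f)) D
            (fun f : L2S2 => ‖f‖ ^ 2) u ξ 1 β (fun τ => β' * logIndex (2 * p) τ)) := by
  refine ⟨fun R hR => ⟨6 * R, fun f => ⟨gradRep R f, gradRep_ae_eq hR f, memSphereA_gradRep hR f,
    sphereNorm_gradRep_le hR f⟩⟩, ⟨(4 * Real.pi) ^ (5 / 2 : ℝ), by positivity,
    fun R hR => exists_smoothingProperty hR⟩, fun R hR p hp u hu ξ hξ D _ =>
    exists_variationalSourceCondition hR hp hu hξ D⟩
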